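/- **Setting.** Let $\Omega\subset\mathbb R^2$ be a bounded domain with smooth boundary $\Gamma$. Let $\mathcal M_h$ be a mesh of $\bar\Omega$ by curved triangles $K$, each with at most one curved edge, the curved edges $E\in\mathcal E_h$ being the edges that lie on $\Gamma$; they cover $\Gamma$, and each $E$ is the shorter arc of $\Gamma$ between its end points. Let $\tilde K$ be the straight triangle with the same vertices as $K$; the $\tilde K$ form a conforming triangulation of $\Omega_h=\bigcup_K\tilde K$. Put $h=\max_K h_{\tilde K}$, where $h_{\tilde K}$ is the diameter of $\tilde K$, let $\rho_{\tilde K}$ be the diameter of the largest circle inscribed in $\tilde K$, and let $h_E$ be the diameter of $E$. Each $E$ is the image of $[0,1]$ under a smooth injective map $F_E$. For a fixed constant $\kappa$, assume for all $K,K'\in\mathcal M_h$, $E\in\mathcal E_h$ $$h_{\tilde K}\le\kappa\rho_{\tilde K},\quad h_{\tilde K}\le\kappa h_{\tilde K'},\quad \kappa^{-1}h_E\le|F_E'|\le\kappa h_E\ \text{ on }[0,1].$$ Let $V_h$ be the space of continuous functions on $\Omega_h$ that are affine on every $\tilde K$, and $Q_h$ the space of continuous $\mu$ on $\Gamma$ with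 $\mu\circ F_E$ affine on $[0,1]$ for every $E$. For $v\in V_h$, $\Pi_hv\in Q_h$ has the same values as $v$ at the nodes on $\Gamma$; $I_h:C(\bar\Omega)\to V_h$ is Lagrange interpolation. Let $x_1,\dots,x_n\in\Gamma$ be distinct points with $s_{\max}\le B\,s_{\min}$ for a fixed constant $B$, where $s_{\max}=\sup_{x\in\Gamma}\min_i s(x,x_i)$, $s_{\min}=\min_{i\ne j}s(x_i,x_j)$ and $s$ is arc length distance on $\Gamma$ ($\infty$ between different components). Assume that each $E$ contains $n_E\ge2$ of them, with parameters $t_1<\dots<t_{n_E}$ under $F_E^{-1}$; put $t_0=0$, $t_{n_E+1}=1$, $\Delta_k=t_k-t_{k-1}$, $\omega_{1,E}=\Delta_1+\frac12\Delta_2$, $\omega_{k,E}=\frac12(\Delta_k+\Delta_{k+1})$ for $1<k<n_E$, $\omega_{n_E,E}=\frac12\Delta_{n_E}+\Delta_{n_E+1}$, and $$\alpha_j=\sum_{E\ni x_j}\omega_{k,E}|F_E'(t_k)|\ \text{ with } F_E(t_k)=x_j,\qquad \langle a,b\rangle_n=\sum_{j=1}^n\alpha_ja_jb_j,$$ where a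 function on $\Gamma$ enters $\langle\cdot,\cdot\rangle_n$ through its values at the $x_j$. Norms: $$\|v\|_{V_h}^2=\|\nabla v\|_{L^2(\Omega_h)}^2+\sum_Eh_E^{-1}\|\Pi_hv\|_{L^2(E)}^2,\qquad \|\mu\|_{Q_h}^2=\sum_Eh_E\|\mu\|_{L^2(E)}^2 .$$ **Theorem.** There are constants $h_0>0$ and $C>0$, depending only on $\Omega,\kappa,B$ (in particular not on the mesh, $h$, $n$ or the data), such that for every such mesh with $h\le h_0$ and all such points the following holds for all $f\in C(\bar\Omega)$, $g_0\in C(\Gamma)$ and $e\in\mathbb R^n$, with $g_i=g_0(x_i)+e_i$. The problem of finding $(u_h,\lambda_h)\in V_h\times Q_h$ with $$(\nabla u_h,\nabla v_h)_{L^2(\Omega_h)}+\langle\lambda_h,\Pi_hv_h\rangle_n=(I_hf,v_h)_{L^2(\Omega_h)}\quad\forall v_h\in V_h,$$ $$\langle\mu_h,\Pi_hu_h\rangle_n=\langle\mu_h,g\rangle_n\quad\forall\mu_h\in Q_h$$ has a unique solution, and for all $(u_I,\lambda_I)\in V_h\times Q_h$ $$\|u_h-u_I\|_{V_h}+\|\lambda_h-\lambda_I\|_{Q_h}\le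 C(M_{1h}+M_{2h}+M_{3h}),$$ where $$M_{1h}=\sup_{v_h\in V_h\setminus\{0\}}\frac{|(\nabla u_I,\nabla v_h)_{L^2(\Omega_h)}+\langle\lambda_I,\Pi_hv_h\rangle_n-(I_hf,v_h)_{L^2(\Omega_h)}|}{\|v_h\|_{V_h}},$$ $$M_{2h}=\sup_{\mu_h\in Q_h\setminus\{0\}}\frac{|\langle\mu_h,\Pi_hu_I-g_0\rangle_n|}{\|\mu_h\|_{Q_h}},\qquad M_{3h}=\sup_{\mu_h\in Q_h\setminus\{0\}}\frac{|\langle\mu_h,e\rangle_n|}{\|\mu_h\|_{Q_h}}.$$ -/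

import Mathlib

open Set MeasureTheory
open scoped ENNReal ContDiff

/-- The Euclidean plane. -/
abbrev Plane : Type := EuclideanSpace ℝ (Fin 2)

/-- A bounded planar domain with smooth boundary: near each boundary point, in suitable
orthonormal coordinates, the domain is the strict epigraph of a smooth function. -/
structure IsSmoothBoundedDomain (Ω : Set Plane) : Prop where
  isOpen : IsOpen Ω
  isConnected : IsConnected Ω
  isBounded : Bornology.IsBounded Ω
  smooth_boundary : ∀ x ∈ frontier Ω, ∃ r > 0, ∃ R : Plane ≃ₗᵢ[ℝ] Plane, ∃ φ : ℝ → ℝ,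
    ContDiff ℝ ∞ φ ∧ ∀ y ∈ Metric.ball x r, (y ∈ Ω ↔ φ (R y 0) < R y 1)

/-- Arc length distance `s(x, y)` on a curve `Γ`: the least length of a path in `Γ` from `x` to `y`
(`∞` if there is none, i.e. if the points lie on different components). -/
noncomputable def arcDist (Γ : Set Plane) (x y : Plane) : ℝ≥0∞ :=
  ⨅ (γ : ℝ → Plane) (_ : ContinuousOn γ (Icc 0 1) ∧ MapsTo γ (Icc 0 1) Γ ∧ γ 0 = x ∧ γ 1 = y),
    eVariationOn γ (Icc 0 1)

/-- Union of the closed straight triangles with the given vertex sets. -/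
def polygonalDomain (tri : Finset (Finset Plane)) : Set Plane :=
  ⋃ t ∈ tri, convexHull ℝ (t : Set Plane)

/-- Extension by zero of a function on a subset of the plane. -/
noncomputable def zeroExt {s : Set Plane} (v : C(s, ℝ)) : Plane → ℝ :=
  Function.extend Subtype.val v 0

theorem zeroExt_apply {s : Set Plane} (v : C(s, ℝ)) {x : Plane} (hx : x ∈ s) :
    zeroExt v x = v ⟨x, hx⟩ :=
  Subtype.val_injective.extend_apply v 0 ⟨x, hx⟩

theorem zeroExt_add {s : Set Plane} (v w : C(s, ℝ)) (x : Plane) :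
    zeroExt (v + w) x = zeroExt v x + zeroExt w x := by
  by_cases hx : x ∈ s
  · simp [zeroExt_apply _ hx]
  · have h : ¬ ∃ a : s, (a : Plane) = x := fun ⟨a, ha⟩ => hx (ha ▸ a.2)
    simp [zeroExt, Function.extend_apply' _ _ _ h]

theorem zeroExt_smul {s : Set Plane} (c : ℝ) (v : C(s, ℝ)) (x : Plane) :
    zeroExt (c • v) x = c * zeroExt v x := by
  by_cases hx : x ∈ s
  · simp [zeroExt_apply _ hx]
  · have h : ¬ ∃ a : s, (a : Plane) = x := fun ⟨a, ha⟩ => hx (ha ▸ a.2)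
    simp [zeroExt, Function.extend_apply' _ _ _ h]

theorem zeroExt_zero {s : Set Plane} (x : Plane) : zeroExt (0 : C(s, ℝ)) x = 0 := by
  simpa using zeroExt_smul (s := s) 0 0 x

/-- A mesh of (the closure of) `Ω` by curved triangles, together with parametrizations of the
boundary elements.

A curved triangle `K` is recorded through the vertex set `t` of the straight triangle with the same
vertices (`convexHull ℝ t`) and a homeomorphism `Φ` of the union of all straight triangles onto
`closure Ω`, so that `K = Φ '' convexHull ℝ t`. The map `Φ` fixes every straight edge pointwise and
maps a straight edge `e ∈ bd` onto the boundary element `E = F e '' Icc 0 1`. -/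
structure CurvedMesh (Ω : Set Plane) where
  /-- vertex sets of the triangles -/
  tri : Finset (Finset Plane)
  /-- vertex pairs of the edges lying on the boundary of `Ω` -/
  bd : Finset (Finset Plane)
  /-- parametrizations over `[0, 1]` of the boundary elements -/
  F : Finset Plane → ℝ → Plane
  /-- the homeomorphism carrying the straight triangles to the curved ones -/
  Φ : Plane → Plane
  card_tri : ∀ t ∈ tri, t.card = 3
  indep_tri : ∀ t ∈ tri, AffineIndependent ℝ ((↑) : t → Plane)
  /-- the straight triangles form a conforming triangulation -/
  inter_tri : ∀ t ∈ tri, ∀ t' ∈ tri,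
    convexHull ℝ (t : Set Plane) ∩ convexHull ℝ (t' : Set Plane) ⊆
      convexHull ℝ ((t : Set Plane) ∩ (t' : Set Plane))
  bd_sub : ∀ e ∈ bd, ∃ t ∈ tri, e ⊆ t
  /-- each curved triangle has at most one edge on the boundary -/
  bd_unique : ∀ t ∈ tri, ∀ e ∈ bd, ∀ e' ∈ bd, e ⊆ t → e' ⊆ t → e = e'
  bd_ends : ∀ e ∈ bd, (e : Set Plane) = {F e 0, F e 1}
  bd_ne : ∀ e ∈ bd, F e 0 ≠ F e 1
  F_smooth : ∀ e ∈ bd, ContDiffOn ℝ ∞ (F e) (Icc 0 1)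
  /-- the boundary elements cover the boundary of `Ω` -/
  bd_cover : ⋃ e ∈ bd, F e '' Icc 0 1 = frontier Ω
  /-- a boundary element is the shorter arc between its end points, never the long way round a
  boundary component -/
  bd_short : ∀ e ∈ bd, eVariationOn (F e) (Icc 0 1) ≤ arcDist (frontier Ω) (F e 0) (F e 1)
  Φ_cont : ContinuousOn Φ (polygonalDomain tri)
  Φ_inj : InjOn Φ (polygonalDomain tri)
  Φ_image : Φ '' polygonalDomain tri = closure Ω
  Φ_straight : ∀ t ∈ tri, ∀ e ⊆ t, e.card = 2 → e ∉ bd → ∀ x ∈ convexHull ℝ (e : Set Plane), Φ x = x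
  Φ_bd : ∀ e ∈ bd, ∀ s ∈ Icc (0 : ℝ) 1, Φ (AffineMap.lineMap (F e 0) (F e 1) s) = F e s

namespace CurvedMesh

variable {Ω : Set Plane} (M : CurvedMesh Ω)

/-- The closed polygonal domain `Ω_h`. -/
def Ωh : Set Plane := polygonalDomain M.tri

/-- The diameter of the straight triangle with vertex set `t`. -/
noncomputable def hK (t : Finset Plane) : ℝ := Metric.diam (convexHull ℝ (t : Set Plane))

/-- The diameter of the largest circle inscribed in the straight triangle with vertex set `t`. -/
noncomputable def ρK (t : Finset Plane) : ℝ :=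
  sSup {d : ℝ | ∃ (c : Plane) (r : ℝ), 0 ≤ r ∧ d = 2 * r ∧
    Metric.closedBall c r ⊆ convexHull ℝ (t : Set Plane)}

/-- The mesh size: the largest diameter of a straight triangle. -/
noncomputable def h : ℝ := ⨆ t : M.tri, hK t.1

/-- The boundary element `E` belonging to `e ∈ bd`. -/
def elem (e : Finset Plane) : Set Plane := M.F e '' Icc 0 1

/-- The diameter `h_E` of a boundary element. -/
noncomputable def hE (e : Finset Plane) : ℝ := Metric.diam (M.elem e)

/-- The derivative of the parametrization of a boundary element. -/
noncomputable def dF (e : Finset Plane) (s : ℝ) : Plane := derivWithin (M.F e) (Icc 0 1) s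

/-- Shape regularity and quasi-uniformity of the straight mesh, and the uniform regularity
`‖F_E'‖ ≤ κ h_E`, `‖D_T F_E⁻¹‖ ≤ κ h_E⁻¹` of the boundary parametrizations (the tangential
derivative of `F_E⁻¹` has modulus `1 / ‖F_E'‖`), all with the same constant `κ`. -/
structure IsRegular (κ : ℝ) : Prop where
  shape : ∀ t ∈ M.tri, hK t ≤ κ * ρK t
  quasi_uniform : ∀ t ∈ M.tri, ∀ t' ∈ M.tri, hK t ≤ κ * hK t'
  dF_le : ∀ e ∈ M.bd, ∀ s ∈ Icc (0 : ℝ) 1, ‖M.dF e s‖ ≤ κ * M.hE e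
  le_dF : ∀ e ∈ M.bd, ∀ s ∈ Icc (0 : ℝ) 1, M.hE e ≤ κ * ‖M.dF e s‖

/-- The space `V_h` of continuous functions on `Ω_h` that are affine on every straight triangle. -/
def Vh : Submodule ℝ C(M.Ωh, ℝ) where
  carrier := {v | ∀ t ∈ M.tri, ∃ a : Plane →ᵃ[ℝ] ℝ,
    ∀ x ∈ convexHull ℝ (t : Set Plane), zeroExt v x = a x}
  add_mem' := by
    intro v w hv hw t ht
    obtain ⟨a, ha⟩ := hv t ht
    obtain ⟨b, hb⟩ := hw t ht
    exact ⟨a + b, fun x hx => by simp [zeroExt_add, ha x hx, hb x hx]⟩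
  zero_mem' := fun t _ => ⟨0, fun x _ => by simp [zeroExt_zero]⟩
  smul_mem' := by
    intro c v hv t ht
    obtain ⟨a, ha⟩ := hv t ht
    exact ⟨c • a, fun x hx => by simp [zeroExt_smul, ha x hx]⟩

/-- The space `Q_h` of continuous functions on `Γ = ∂Ω` whose pull-back to `[0, 1]` by each
parametrization is affine. -/
def Qh : Submodule ℝ C(frontier Ω, ℝ) where
  carrier := {μ | ∀ e ∈ M.bd, ∃ p q : ℝ, ∀ s ∈ Icc (0 : ℝ) 1, zeroExt μ (M.F e s) = p + q * s}
  add_mem' := by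
    intro v w hv hw t ht
    obtain ⟨p, q, ha⟩ := hv t ht
    obtain ⟨p', q', hb⟩ := hw t ht
    exact ⟨p + p', q + q', fun x hx => by rw [zeroExt_add, ha x hx, hb x hx]; ring⟩
  zero_mem' := fun t _ => ⟨0, 0, fun x _ => by simp [zeroExt_zero]⟩
  smul_mem' := by
    intro c v hv t ht
    obtain ⟨p, q, ha⟩ := hv t ht
    exact ⟨c * p, c * q, fun x hx => by rw [zeroExt_smul, ha x hx]; ring⟩

theorem isCompact_Ωh : IsCompact M.Ωh :=
  M.tri.finite_toSet.isCompact_biUnion fun t _ => t.finite_toSet.isCompact_convexHull ℝ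

theorem mem_Ωh {t : Finset Plane} (ht : t ∈ M.tri) {x : Plane}
    (hx : x ∈ convexHull ℝ (t : Set Plane)) : x ∈ M.Ωh :=
  mem_biUnion (Finset.mem_coe.2 ht) hx

theorem F_mem {e : Finset Plane} (he : e ∈ M.bd) {s : ℝ} (hs : s ∈ Icc (0 : ℝ) 1) :
    M.F e s ∈ frontier Ω :=
  M.bd_cover ▸ mem_biUnion (Finset.mem_coe.2 he) (mem_image_of_mem _ hs)

theorem F_zero_mem {e : Finset Plane} (he : e ∈ M.bd) : M.F e 0 ∈ e := by
  have : M.F e 0 ∈ (e : Set Plane) := by rw [M.bd_ends e he]; simp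
  exact this

theorem F_one_mem {e : Finset Plane} (he : e ∈ M.bd) : M.F e 1 ∈ e := by
  have : M.F e 1 ∈ (e : Set Plane) := by rw [M.bd_ends e he]; simp
  exact this

theorem lineMap_mem {e t : Finset Plane} (he : e ∈ M.bd) (het : e ⊆ t) {s : ℝ}
    (hs : s ∈ Icc (0 : ℝ) 1) :
    AffineMap.lineMap (M.F e 0) (M.F e 1) s ∈ convexHull ℝ (t : Set Plane) :=
  (convex_convexHull ℝ _).segment_subset
    (subset_convexHull ℝ _ (het (M.F_zero_mem he)))
    (subset_convexHull ℝ _ (het (M.F_one_mem he)))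
    (by rw [segment_eq_image_lineMap]; exact mem_image_of_mem _ hs)

/-- The transfer `Π_h v_h ∈ Q_h` with the same values as `v_h` at the boundary nodes is well
defined. -/
theorem existsUnique_Pi (v : M.Vh) : ∃! w : M.Qh, ∀ e ∈ M.bd, ∀ y ∈ e,
    zeroExt (w : C(frontier Ω, ℝ)) y = zeroExt (v : C(M.Ωh, ℝ)) y := by
  have hst : ∀ e ∈ M.bd, ∀ s ∈ Icc (0 : ℝ) 1,
      AffineMap.lineMap (M.F e 0) (M.F e 1) s ∈ M.Ωh := by
    intro e he s hs
    obtain ⟨t, ht, het⟩ := M.bd_sub e he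
    exact M.mem_Ωh ht (M.lineMap_mem he het hs)
  have hbij : BijOn M.Φ M.Ωh (closure Ω) := by
    refine ⟨?_, M.Φ_inj, ?_⟩
    · intro z hz
      rw [← M.Φ_image]
      exact mem_image_of_mem _ hz
    · rw [← M.Φ_image]
      exact surjOn_image _ _
  let ψ : M.Ωh ≃ closure Ω := hbij.equiv
  have hψ : Continuous ψ :=
    (continuousOn_iff_continuous_domRestrict.1 M.Φ_cont).subtype_mk _
  have : CompactSpace M.Ωh := isCompact_iff_compactSpace.1 M.isCompact_Ωh
  let H : M.Ωh ≃ₜ closure Ω := hψ.homeoOfEquivCompactToT2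
  let w : C(frontier Ω, ℝ) := ⟨fun y => (v : C(M.Ωh, ℝ)) (H.symm ⟨y, frontier_subset_closure y.2⟩),
    (v : C(M.Ωh, ℝ)).continuous.comp (H.symm.continuous.comp (by fun_prop))⟩
  have hw : ∀ e ∈ M.bd, ∀ s ∈ Icc (0 : ℝ) 1, zeroExt w (M.F e s) =
      zeroExt (v : C(M.Ωh, ℝ)) (AffineMap.lineMap (M.F e 0) (M.F e 1) s) := by
    intro e he s hs
    rw [zeroExt_apply _ (M.F_mem he hs), zeroExt_apply _ (hst e he s hs)]
    change (v : C(M.Ωh, ℝ)) (H.symm _) = _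
    congr 1
    rw [Homeomorph.symm_apply_eq]
    exact Subtype.ext (M.Φ_bd e he s hs).symm
  have hwQ : w ∈ M.Qh := by
    intro e he
    obtain ⟨t, ht, het⟩ := M.bd_sub e he
    obtain ⟨a, ha⟩ := v.2 t ht
    refine ⟨a (M.F e 0), a (M.F e 1) - a (M.F e 0), fun s hs => ?_⟩
    rw [hw e he s hs, ha _ (M.lineMap_mem he het hs), AffineMap.apply_lineMap,
      AffineMap.lineMap_apply]
    simp only [vsub_eq_sub, smul_eq_mul, vadd_eq_add]
    ring
  have h0 : (0 : ℝ) ∈ Icc (0 : ℝ) 1 := by simp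
  have h1 : (1 : ℝ) ∈ Icc (0 : ℝ) 1 := by simp
  have hnode : ∀ e ∈ M.bd, ∀ y ∈ e, zeroExt w y = zeroExt (v : C(M.Ωh, ℝ)) y := by
    intro e he y hy
    have hy' : y ∈ (e : Set Plane) := hy
    rw [M.bd_ends e he] at hy'
    rcases hy' with rfl | rfl
    · simpa using hw e he 0 h0
    · simpa using hw e he 1 h1
  refine ⟨⟨w, hwQ⟩, hnode, ?_⟩
  rintro ⟨w', hwQ'⟩ hnode'
  apply Subtype.ext
  ext ⟨y, hy⟩
  have hy2 := hy
  rw [← M.bd_cover] at hy2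
  simp only [mem_iUnion] at hy2
  obtain ⟨e, he, s, hs, rfl⟩ := hy2
  obtain ⟨p, q, hpq⟩ := hwQ e he
  obtain ⟨p', q', hpq'⟩ := hwQ' e he
  have e0 := hnode' e he _ (M.F_zero_mem he)
  have e1 := hnode' e he _ (M.F_one_mem he)
  rw [← hnode e he _ (M.F_zero_mem he)] at e0
  rw [← hnode e he _ (M.F_one_mem he)] at e1
  change zeroExt w' _ = _ at e0 e1
  rw [hpq' _ h0, hpq _ h0] at e0
  rw [hpq' _ h1, hpq _ h1] at e1
  have hp : p' = p := by linarith
  have hq : q' = q := by linarith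
  change w' ⟨M.F e s, hy⟩ = w ⟨M.F e s, hy⟩
  rw [← zeroExt_apply w' hy, ← zeroExt_apply w hy, hpq' s hs, hpq s hs, hp, hq]

/-- The operator `Π_h : V_h → Q_h`. -/
noncomputable def Pi (v : M.Vh) : M.Qh := (M.existsUnique_Pi v).exists.choose

/-- The Lagrange interpolant is well defined. -/
theorem existsUnique_interp (f : Plane → ℝ) : ∃! w : M.Vh, ∀ t ∈ M.tri, ∀ y ∈ t,
    zeroExt (w : C(M.Ωh, ℝ)) y = f y := by
  classical
  have haff : ∀ t ∈ M.tri, ∃ a : Plane →ᵃ[ℝ] ℝ, ∀ y ∈ t, a y = f y := by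
    intro t ht
    have hspan : affineSpan ℝ (range ((↑) : t → Plane)) = ⊤ := by
      rw [(M.indep_tri t ht).affineSpan_eq_top_iff_card_eq_finrank_add_one]
      simp [M.card_tri t ht]
    let b : AffineBasis t ℝ Plane := ⟨(↑), M.indep_tri t ht, hspan⟩
    refine ⟨∑ i : t, f i • b.coord i, fun y hy => ?_⟩
    have hc : ∀ i : t, b.coord i y = if i = ⟨y, hy⟩ then 1 else 0 :=
      fun i => b.coord_apply i ⟨y, hy⟩
    have hev : ∀ (S : Finset t), (∑ i ∈ S, f i • b.coord i) y = ∑ i ∈ S, f i * b.coord i y := by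
      intro S
      induction S using Finset.induction_on with
      | empty => simp
      | insert i S hi ih => simp [Finset.sum_insert hi, ih]
    rw [hev]
    simp [hc]
  choose! a ha using haff
  have heqOn : ∀ (b c : Plane →ᵃ[ℝ] ℝ) (s : Set Plane), (∀ y ∈ s, b y = c y) →
      ∀ y ∈ convexHull ℝ s, b y = c y := by
    intro b c s hs y hy
    have hsub : convexHull ℝ s ⊆ (affineSpan ℝ s : Set Plane) := convexHull_subset_affineSpan s
    exact AffineMap.eqOn_affineSpan (f := b) (g := c) hs (hsub hy)
  have hagree : ∀ t ∈ M.tri, ∀ t' ∈ M.tri, ∀ y ∈ convexHull ℝ (t : Set Plane),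
      y ∈ convexHull ℝ (t' : Set Plane) → a t y = a t' y := by
    intro t ht t' ht' y hy hy'
    refine heqOn _ _ _ ?_ y (M.inter_tri t ht t' ht' ⟨hy, hy'⟩)
    rintro z ⟨hz, hz'⟩
    rw [ha t ht z hz, ha t' ht' z hz']
  have hex : ∀ y : M.Ωh, ∃ t, t ∈ M.tri ∧ (y : Plane) ∈ convexHull ℝ (t : Set Plane) := by
    rintro ⟨y, hy⟩
    simpa [CurvedMesh.Ωh, polygonalDomain] using hy
  choose T hT hyT using hex
  let w₀ : M.Ωh → ℝ := fun y => a (T y) y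
  have hw₀ : ∀ t ∈ M.tri, ∀ y : M.Ωh, (y : Plane) ∈ convexHull ℝ (t : Set Plane) →
      w₀ y = a t y := fun t ht y hy => hagree _ (hT y) t ht _ (hyT y) hy
  have hcont : Continuous w₀ := by
    refine LocallyFinite.continuous
      (f := fun t : M.tri => {y : M.Ωh | (y : Plane) ∈ convexHull ℝ (t.1 : Set Plane)})
      (locallyFinite_of_finite _) ?_ ?_ ?_
    · ext y
      simp only [mem_iUnion, mem_univ, iff_true]
      exact ⟨⟨T y, hT y⟩, hyT y⟩
    · intro t
      exact (t.1.finite_toSet.isCompact_convexHull ℝ).isClosed.preimage continuous_subtype_val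
    · intro t
      refine ContinuousOn.congr (f := fun y : M.Ωh => a t.1 y) ?_ fun y hy => hw₀ t.1 t.2 y hy
      exact ((a t.1).continuous_of_finiteDimensional.comp continuous_subtype_val).continuousOn
  have hmem : (⟨w₀, hcont⟩ : C(M.Ωh, ℝ)) ∈ M.Vh := by
    intro t ht
    refine ⟨a t, fun y hy => ?_⟩
    rw [zeroExt_apply _ (M.mem_Ωh ht hy)]
    exact hw₀ t ht _ hy
  have hnode : ∀ t ∈ M.tri, ∀ y ∈ t, zeroExt (⟨w₀, hcont⟩ : C(M.Ωh, ℝ)) y = f y := by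
    intro t ht y hy
    have hy' : y ∈ convexHull ℝ (t : Set Plane) := subset_convexHull ℝ _ hy
    rw [zeroExt_apply _ (M.mem_Ωh ht hy')]
    exact (hw₀ t ht _ hy').trans (ha t ht y hy)
  refine ⟨⟨_, hmem⟩, hnode, ?_⟩
  rintro ⟨w', hw'⟩ hnode'
  apply Subtype.ext
  ext y
  obtain ⟨b, hb⟩ := hw' (T y) (hT y)
  have h1 : w' y = b y := by
    rw [← hb y (hyT y), zeroExt_apply w' y.2]
  change w' y = a (T y) y
  rw [h1]
  refine heqOn _ _ _ ?_ _ (hyT y)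
  intro z hz
  rw [ha _ (hT y) z hz, ← hb z (subset_convexHull ℝ _ hz)]
  exact hnode' _ (hT y) z hz

/-- The Lagrange interpolation operator `I_h`; it uses only the values of `f` at the nodes. -/
noncomputable def interp (f : Plane → ℝ) : M.Vh := (M.existsUnique_interp f).exists.choose

/-- `(∇u, ∇v)_{Ω_h}`. The functions are affine on each triangle, so that their gradient exists
off the edges, a null set. -/
noncomputable def gradInner (u v : M.Vh) : ℝ :=
  ∫ x in M.Ωh, inner ℝ (gradient (zeroExt (u : C(M.Ωh, ℝ))) x)
    (gradient (zeroExt (v : C(M.Ωh, ℝ))) x)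

/-- `(u, v)_{Ω_h}`. -/
noncomputable def l2Inner (u v : M.Vh) : ℝ :=
  ∫ x in M.Ωh, zeroExt (u : C(M.Ωh, ℝ)) x * zeroExt (v : C(M.Ωh, ℝ)) x

/-- `‖μ‖²_{L²(E)}` with respect to arc length. -/
noncomputable def l2SqE (μ : M.Qh) (e : Finset Plane) : ℝ :=
  ∫ s in (0 : ℝ)..1, zeroExt (μ : C(frontier Ω, ℝ)) (M.F e s) ^ 2 * ‖M.dF e s‖

/-- `‖v‖_{V_h} = (‖∇v‖² + ‖Π_h v‖²_{1/2,h})^{1/2}`. -/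
noncomputable def normV (v : M.Vh) : ℝ :=
  Real.sqrt (M.gradInner v v + ∑ e ∈ M.bd, (M.hE e)⁻¹ * M.l2SqE (M.Pi v) e)

/-- `‖μ‖_{Q_h} = ‖μ‖_{-1/2,h}`. -/
noncomputable def normQ (μ : M.Qh) : ℝ :=
  Real.sqrt (∑ e ∈ M.bd, M.hE e * M.l2SqE μ e)

end CurvedMesh

/-! ### Measurement points and the empirical inner product -/

/-- The nodes `t₀ = 0, t₁ < ⋯ < t_m, t_{m+1} = 1`, where `t₁ < ⋯ < t_m` enumerate `S`. -/
noncomputable def quadNode (S : Finset ℝ) (k : ℕ) : ℝ :=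
  if k = 0 then 0 else if hk : k - 1 < S.card then S.orderEmbOfFin rfl ⟨k - 1, hk⟩ else 1

/-- The gaps `Δt_k = t_k - t_{k-1}`. -/
noncomputable def quadGap (S : Finset ℝ) (k : ℕ) : ℝ := quadNode S k - quadNode S (k - 1)

/-- The weights `ω_k` for `1 ≤ k ≤ m`, where `m ≥ 2`. -/
noncomputable def quadWeight (S : Finset ℝ) (k : ℕ) : ℝ :=
  if k = 1 then quadGap S 1 + quadGap S 2 / 2
  else if k = S.card then quadGap S k / 2 + quadGap S (k + 1)
  else (quadGap S k + quadGap S (k + 1)) / 2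

/-- The points `x i` are distinct and uniformly distributed over `Γ`: `s_max ≤ B s_min`. -/
structure UniformlyDistributed {Γ : Set Plane} {n : ℕ} (x : Fin n → Γ) (B : ℝ) : Prop where
  injective : Function.Injective x
  ratio : (⨆ y : Γ, ⨅ i, arcDist Γ y (x i)) ≤
    ENNReal.ofReal B * ⨅ (i) (j) (_ : i ≠ j), arcDist Γ (x i) (x j)

namespace CurvedMesh

variable {Ω : Set Plane} (M : CurvedMesh Ω) {n : ℕ} (x : Fin n → frontier Ω)

open Classical in
/-- Indices of the measurement points that lie in the boundary element belonging to `e`. -/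
noncomputable def pts (e : Finset Plane) : Finset (Fin n) :=
  Finset.univ.filter fun i => (x i : Plane) ∈ M.elem e

/-- Parameters `F_E⁻¹(x_i) ∈ [0, 1]` of the measurement points in `E`. -/
noncomputable def params (e : Finset Plane) : Finset ℝ :=
  (M.pts x e).image fun i => Function.invFunOn (M.F e) (Icc 0 1) (x i)

open Classical in
/-- The weights `α_i` of the empirical inner product. -/
noncomputable def weight (i : Fin n) : ℝ :=
  ∑ e ∈ M.bd, ∑ k ∈ Finset.Icc 1 (M.params x e).card,
    if M.F e (quadNode (M.params x e) k) = x i then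
      quadWeight (M.params x e) k * ‖M.dF e (quadNode (M.params x e) k)‖ else 0

/-- `⟨a, b⟩_n = ∑ α_i a_i b_i` for data `a, b` at the measurement points. -/
noncomputable def emp (a b : Fin n → ℝ) : ℝ := ∑ i, M.weight x i * a i * b i

variable {M} in
/-- The values at the measurement points of an element of `Q_h`. -/
def atPts (μ : M.Qh) : Fin n → ℝ := fun i => (μ : C(frontier Ω, ℝ)) (x i)

/-- `(u, l)` solves the discrete Lagrange multiplier problem with source `f` and boundary
observations `g`. -/
def IsDiscreteSolution (f : Plane → ℝ) (g : Fin n → ℝ) (u : M.Vh) (l : M.Qh) : Prop :=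
  (∀ v : M.Vh, M.gradInner u v + M.emp x (atPts x l) (atPts x (M.Pi v)) =
    M.l2Inner (M.interp f) v) ∧
  ∀ μ : M.Qh, M.emp x (atPts x μ) (atPts x (M.Pi u)) = M.emp x (atPts x μ) g

/-- The consistency error `M_{1h}`. -/
noncomputable def err1 (f : Plane → ℝ) (uI : M.Vh) (lI : M.Qh) : ℝ :=
  ⨆ v : {v : M.Vh // v ≠ 0},
    |M.gradInner uI v + M.emp x (atPts x lI) (atPts x (M.Pi v)) - M.l2Inner (M.interp f) v| /
      M.normV v

/-- The boundary data error `M_{2h}`. -/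
noncomputable def err2 (g₀ : C(frontier Ω, ℝ)) (uI : M.Vh) : ℝ :=
  ⨆ μ : {μ : M.Qh // μ ≠ 0},
    |M.emp x (atPts x μ.1) (fun i => atPts x (M.Pi uI) i - g₀ (x i))| / M.normQ μ

/-- The noise term `M_{3h}`. -/
noncomputable def err3 (e : Fin n → ℝ) : ℝ :=
  ⨆ μ : {μ : M.Qh // μ ≠ 0}, |M.emp x (atPts x μ.1) e| / M.normQ μ

end CurvedMesh

/-! The pair of errors `w = u_h - u_I`, `ν = λ_h - λ_I` solves the same saddle point system with
residuals of dual norm at most `M_{1h}` and `M_{2h} + M_{3h}`, so everything rests on a stability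
estimate uniform in the mesh. Because the norms are mesh dependent, no trace theorem is needed:
every boundary quantity is compared with the sum `nodalSq μ` of squared nodal values. Four facts
carry the argument, with constants depending on `Ω`, `κ`, `B` only: `‖μ‖_{Q_h}² ≲ h² nodalSq μ`; the
boundary part of `‖v‖_{V_h}²` is `≲ nodalSq (Π_h v)`; `h nodalSq μ ≲ ⟨μ, μ⟩_n` (`h_mul_nodalSq_le`);
and extension by zero at the interior nodes lifts `μ` with squared gradient norm `≲ nodalSq μ`
(`gradInner_extend_le`).

Given these, `saddlePoint_stability` uses three tests. The lift of `ν` bounds `‖ν‖_{Q_h}` by `M_{1h}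
+ ‖∇w‖`; the multiplier `Π_h w` bounds the boundary part of `w` by the data residual; `v = w`
together with `μ = ν` gives a quadratic inequality for `‖∇w‖`, which is solved by absorption.
Existence and uniqueness come from injectivity in finite dimension.

The substantial point is the lower bound for the empirical form. An arc of an element free of
measurement points has a midpoint far from all of them, while the first two points of the element
bound `s_min` from above; so `s_max ≤ B s_min` bounds the two outer gaps by the first inner one
(`sub_le_mul_quadGap_two`). Hence the measurement points of an element span a fixed fraction of it.
On that span the trapezoidal rule overestimates the integral of a squared affine function, and this
integral controls the two end values (`sq_add_sq_le_quad`).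

The smoothness of the boundary and `h ≤ h₀` serve to bound `h_E` by a multiple of `h`
(`hE_le_mul_h`): for close end points the shorter arc is comparable with its chord. -/

/-! ### Arc length against Euclidean distance on a smooth boundary -/

theorem eVariationOn_le_of_dist_le {γ : ℝ → Plane} {C a b : ℝ} (hC : 0 ≤ C) (hab : a ≤ b)
    (h : ∀ s ∈ Icc a b, ∀ t ∈ Icc a b, dist (γ s) (γ t) ≤ C * |s - t|) :
    eVariationOn γ (Icc a b) ≤ ENNReal.ofReal (C * (b - a)) := by
  have hL : LipschitzOnWith (Real.toNNReal C) γ (Icc a b) :=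
    LipschitzOnWith.of_dist_le_mul fun s hs t ht => by
      rw [Real.coe_toNNReal C hC, Real.dist_eq]; exact h s hs t ht
  have h1 := hL.comp_eVariationOn_le (g := id) (s := Icc a b) (fun x hx => hx)
  have h2 : eVariationOn (id : ℝ → ℝ) (Icc a b) ≤ ENNReal.ofReal (b - a) := by
    have := (monotone_id.monotoneOn (Icc a b)).eVariationOn_eq (left_mem_Icc.2 hab)
      (right_mem_Icc.2 hab)
    rw [inter_self] at this
    exact this.le
  calc eVariationOn γ (Icc a b) ≤ _ := h1
    _ ≤ (Real.toNNReal C : ℝ≥0∞) * ENNReal.ofReal (b - a) := by gcongr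
    _ = _ := by rw [ENNReal.ofReal_mul hC]; rfl

theorem arcDist_le_of_dist_le {Γ : Set Plane} {γ : ℝ → Plane} {C a b : ℝ} (hC : 0 ≤ C)
    (hab : a ≤ b) (hΓ : MapsTo γ (Icc a b) Γ)
    (h : ∀ s ∈ Icc a b, ∀ t ∈ Icc a b, dist (γ s) (γ t) ≤ C * |s - t|) :
    arcDist Γ (γ a) (γ b) ≤ ENNReal.ofReal (C * (b - a)) := by
  have hm : ∀ s ∈ Icc (0 : ℝ) 1, a + s * (b - a) ∈ Icc a b := by
    rintro s ⟨h0, h1⟩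
    constructor
    · nlinarith
    · nlinarith
  have hd : ∀ s ∈ Icc (0 : ℝ) 1, ∀ t ∈ Icc (0 : ℝ) 1,
      dist (γ (a + s * (b - a))) (γ (a + t * (b - a))) ≤ C * (b - a) * |s - t| := by
    intro s hs t ht
    refine (h _ (hm s hs) _ (hm t ht)).trans (le_of_eq ?_)
    rw [show a + s * (b - a) - (a + t * (b - a)) = (b - a) * (s - t) by ring, abs_mul,
      abs_of_nonneg (sub_nonneg.2 hab), mul_assoc]
  have hC' : 0 ≤ C * (b - a) := mul_nonneg hC (sub_nonneg.2 hab)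
  have hcont : ContinuousOn (fun s => γ (a + s * (b - a))) (Icc 0 1) :=
    (LipschitzOnWith.of_dist_le_mul (K := Real.toNNReal (C * (b - a))) fun s hs t ht => by
      rw [Real.coe_toNNReal _ hC', Real.dist_eq]; exact hd s hs t ht).continuousOn
  have := eVariationOn_le_of_dist_le hC' zero_le_one hd
  rw [sub_zero, mul_one] at this
  refine le_trans (iInf₂_le (fun s => γ (a + s * (b - a))) ⟨hcont, ?_, ?_, ?_⟩) this
  · exact fun s hs => hΓ (hm s hs)
  · simp
  · simp

theorem Plane.dist_le_abs_add_abs (x y : Plane) : dist x y ≤ |x 0 - y 0| + |x 1 - y 1| := by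
  rw [EuclideanSpace.dist_eq, Fin.sum_univ_two, Real.dist_eq, Real.dist_eq]
  apply Real.sqrt_le_iff.2
  constructor
  · positivity
  · nlinarith [mul_nonneg (abs_nonneg (x 0 - y 0)) (abs_nonneg (x 1 - y 1))]

theorem Plane.abs_sub_le_dist (x y : Plane) (i : Fin 2) : |x i - y i| ≤ dist x y := by
  have := PiLp.dist_apply_le x y i
  rwa [Real.dist_eq] at this

/-- Where the domain is a strict epigraph, its boundary is the graph. -/
theorem mem_frontier_iff_of_epigraph {Ω : Set Plane} (hΩ : IsOpen Ω) {x : Plane} {r : ℝ}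
    {R : Plane ≃ₗᵢ[ℝ] Plane} {φ : ℝ → ℝ} (hφ : Continuous φ)
    (h : ∀ y ∈ Metric.ball x r, (y ∈ Ω ↔ φ (R y 0) < R y 1)) {y : Plane}
    (hy : y ∈ Metric.ball x r) : y ∈ frontier Ω ↔ φ (R y 0) = R y 1 := by
  have hR : Continuous R := R.continuous
  rw [frontier, hΩ.interior_eq, mem_sdiff, h y hy, not_lt]
  constructor
  · rintro ⟨hc, hle⟩
    refine le_antisymm ?_ hle
    have : y ∈ closure (Metric.ball x r ∩ Ω) := Metric.isOpen_ball.inter_closure ⟨hy, hc⟩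
    have hcl : IsClosed {z : Plane | φ (R z 0) ≤ R z 1} :=
      isClosed_le (by fun_prop) (by fun_prop)
    exact hcl.closure_subset_iff.2 (fun z hz => ((h z hz.1).1 hz.2).le) this
  · intro he
    refine ⟨?_, he.ge⟩
    -- Moving a graph point upwards by small `ε > 0` enters the epigraph, so `y` is a limit of
    -- points of the domain.
    have hcont : Continuous fun ε : ℝ => R.symm (R y + ε • EuclideanSpace.single 1 1) := by
      have := R.symm.continuous
      fun_prop
    have ht : Filter.Tendsto (fun ε : ℝ => R.symm (R y + ε • EuclideanSpace.single 1 1))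
        (nhdsWithin 0 (Ioi 0)) (nhds y) := by
      have := hcont.tendsto 0
      simp only [zero_smul, add_zero, LinearIsometryEquiv.symm_apply_apply] at this
      exact this.mono_left nhdsWithin_le_nhds
    refine mem_closure_of_tendsto ht ?_
    filter_upwards [ht (Metric.isOpen_ball.mem_nhds hy), self_mem_nhdsWithin] with ε hε hpos
    rw [h _ hε]
    have : (0 : ℝ) < ε := hpos
    simp [he, this]

theorem IsSmoothBoundedDomain.isCompact_frontier {Ω : Set Plane} (hΩ : IsSmoothBoundedDomain Ω) :
    IsCompact (frontier Ω) :=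
  Metric.isCompact_of_isClosed_isBounded isClosed_frontier
    (hΩ.isBounded.closure.subset frontier_subset_closure)

theorem IsSmoothBoundedDomain.frontier_nonempty {Ω : Set Plane} (hΩ : IsSmoothBoundedDomain Ω) :
    (frontier Ω).Nonempty := by
  apply nonempty_frontier_iff.2 ⟨hΩ.isConnected.nonempty, ?_⟩
  rintro rfl
  exact NoncompactSpace.noncompact_univ
    (Metric.isCompact_of_isClosed_isBounded isClosed_univ hΩ.isBounded)

/-- Near `z` the boundary is the graph of a locally Lipschitz function. The piece of graph over the
segment between the first coordinates of `x` and `y` is a competitor path, of length at most `(1 +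
L)` times their distance. -/
theorem IsSmoothBoundedDomain.exists_arcDist_le_nhds {Ω : Set Plane}
    (hΩ : IsSmoothBoundedDomain Ω) {z : Plane} (hz : z ∈ frontier Ω) :
    ∃ r > 0, ∃ C ≥ 0, ∀ x ∈ frontier Ω, ∀ y ∈ frontier Ω, dist x z < r → dist y z < r →
      arcDist (frontier Ω) x y ≤ ENNReal.ofReal (C * dist x y) := by
  obtain ⟨r, hr, R, φ, hφ, hep⟩ := hΩ.smooth_boundary z hz
  have hmem := fun {y : Plane} (hy : y ∈ Metric.ball z r) =>
    mem_frontier_iff_of_epigraph hΩ.isOpen hφ.continuous hep hy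
  obtain ⟨L, U, hU, hL⟩ := (hφ.contDiffAt (x := R z 0)).of_le (m := 1) (by norm_cast)
    |>.exists_lipschitzOnWith
  obtain ⟨δ, hδ, hUδ⟩ := Metric.mem_nhds_iff.1 hU
  have hL' : ∀ s ∈ Metric.ball (R z 0) δ, ∀ t ∈ Metric.ball (R z 0) δ,
      |φ s - φ t| ≤ L * |s - t| := fun s hs t ht => hL.dist_le_mul s (hUδ hs) t (hUδ ht)
  have hL0 : (0 : ℝ) ≤ L := L.2
  -- The bound by `δ` keeps the Lipschitz estimate valid; the other one keeps the graph over the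
  -- ball of radius `r'` inside the ball of radius `r`, where the epigraph description holds.
  let r' := min δ (r / (2 * (1 + L)))
  have hr' : 0 < r' := by positivity
  have hr'δ : r' ≤ δ := min_le_left _ _
  have hr'r : (1 + L) * r' < r := by
    have : r' ≤ r / (2 * (1 + L)) := min_le_right _ _
    rw [le_div_iff₀ (by positivity)] at this
    nlinarith
  have hr'' : r' < r := by nlinarith
  have hzφ : φ (R z 0) = R z 1 := (hmem (Metric.mem_ball_self hr)).1 hz
  refine ⟨r', hr', 1 + L, by positivity, fun x hx y hy hxz hyz => ?_⟩
  have hxφ : φ (R x 0) = R x 1 := (hmem (hxz.trans hr'')).1 hx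
  have hyφ : φ (R y 0) = R y 1 := (hmem (hyz.trans hr'')).1 hy
  let σ : ℝ → ℝ := fun τ => R x 0 + τ * (R y 0 - R x 0)
  have hxb : R x 0 ∈ Metric.ball (R z 0) r' := by
    rw [Metric.mem_ball, Real.dist_eq]
    exact (Plane.abs_sub_le_dist _ _ 0).trans_lt (by rwa [R.dist_map])
  have hyb : R y 0 ∈ Metric.ball (R z 0) r' := by
    rw [Metric.mem_ball, Real.dist_eq]
    exact (Plane.abs_sub_le_dist _ _ 0).trans_lt (by rwa [R.dist_map])
  have hσ : ∀ τ ∈ Icc (0 : ℝ) 1, σ τ ∈ Metric.ball (R z 0) r' := by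
    rintro τ hτ
    have := (convex_ball (R z 0) r').add_smul_sub_mem hxb hyb hτ
    simpa [σ] using this
  let G : ℝ → Plane := fun s => !₂[s, φ s]
  have hG : ∀ s ∈ Metric.ball (R z 0) δ, ∀ t ∈ Metric.ball (R z 0) δ,
      dist (G s) (G t) ≤ (1 + L) * |s - t| := by
    intro s hs t ht
    refine (Plane.dist_le_abs_add_abs _ _).trans ?_
    have := hL' s hs t ht
    simp only [G, Matrix.cons_val_zero, Matrix.cons_val_one]
    linarith
  have hGR : ∀ w : Plane, φ (R w 0) = R w 1 → G (R w 0) = R w := by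
    intro w hw
    ext i
    fin_cases i <;> simp [G, hw]
  let γ : ℝ → Plane := fun τ => R.symm (G (σ τ))
  have hγ0 : γ 0 = x := by simp [γ, σ, hGR x hxφ]
  have hγ1 : γ 1 = y := by simp [γ, σ, hGR y hyφ]
  have hRG : ∀ τ, R (γ τ) = G (σ τ) := fun τ => by simp [γ]
  have key := arcDist_le_of_dist_le (Γ := frontier Ω) (γ := γ) (C := (1 + L) * dist x y)
    (a := 0) (b := 1) (by positivity) zero_le_one ?_ ?_
  · simpa [hγ0, hγ1] using key
  · intro τ hτ
    have hb : γ τ ∈ Metric.ball z r := by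
      rw [Metric.mem_ball, ← R.dist_map, hRG, ← hGR z hzφ]
      refine (hG _ (Metric.ball_subset_ball hr'δ (hσ τ hτ)) _ (Metric.mem_ball_self hδ)).trans_lt ?_
      refine lt_of_le_of_lt ?_ hr'r
      have := Metric.mem_ball.1 (hσ τ hτ)
      rw [Real.dist_eq] at this
      gcongr
    rw [hmem hb, hRG]
    simp [G]
  · intro s hs t ht
    rw [← R.dist_map, hRG, hRG]
    refine (hG _ (Metric.ball_subset_ball hr'δ (hσ s hs)) _
      (Metric.ball_subset_ball hr'δ (hσ t ht))).trans ?_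
    have h1 : σ s - σ t = (s - t) * (R y 0 - R x 0) := by simp only [σ]; ring
    have h2 : |R y 0 - R x 0| ≤ dist x y := by
      rw [dist_comm, ← R.dist_map]
      exact Plane.abs_sub_le_dist _ _ 0
    rw [h1, abs_mul, mul_assoc, mul_comm |s - t|]
    gcongr

/-- On a smooth compact curve, the arc length distance of close points is bounded by a multiple of
their Euclidean distance. -/
theorem IsSmoothBoundedDomain.exists_arcDist_le {Ω : Set Plane} (hΩ : IsSmoothBoundedDomain Ω) :
    ∃ r > 0, ∃ C ≥ 1, ∀ x ∈ frontier Ω, ∀ y ∈ frontier Ω, dist x y < r →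
      arcDist (frontier Ω) x y ≤ ENNReal.ofReal (C * dist x y) := by
  -- The doubled membership separates the set varied in the compactness induction from the boundary
  -- itself. Only `x` is restricted to that set; `y` stays free, so the property survives unions.
  suffices H : ∃ r > 0, ∃ C ≥ 1, ∀ x ∈ frontier Ω, x ∈ frontier Ω → ∀ y ∈ frontier Ω,
      dist x y < r → arcDist (frontier Ω) x y ≤ ENNReal.ofReal (C * dist x y) by
    obtain ⟨r, hr, C, hC, h⟩ := H
    exact ⟨r, hr, C, hC, fun x hx => h x hx hx⟩
  refine hΩ.isCompact_frontier.induction_on (p := fun s => ∃ r > 0, ∃ C ≥ 1, ∀ x ∈ s,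
    x ∈ frontier Ω → ∀ y ∈ frontier Ω, dist x y < r →
      arcDist (frontier Ω) x y ≤ ENNReal.ofReal (C * dist x y)) ?_ ?_ ?_ ?_
  · exact ⟨1, one_pos, 1, le_rfl, fun x hx => hx.elim⟩
  · rintro s t hst ⟨r, hr, C, hC, h⟩
    exact ⟨r, hr, C, hC, fun x hx => h x (hst hx)⟩
  · rintro s t ⟨r, hr, C, hC, h⟩ ⟨r', hr', C', hC', h'⟩
    refine ⟨min r r', lt_min hr hr', max C C', le_max_of_le_left hC, ?_⟩
    rintro x (hx | hx) hxΓ y hy hxy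
    · refine (h x hx hxΓ y hy (hxy.trans_le (min_le_left _ _))).trans ?_
      gcongr
      exact le_max_left _ _
    · refine (h' x hx hxΓ y hy (hxy.trans_le (min_le_right _ _))).trans ?_
      gcongr
      exact le_max_right _ _
  · intro z hz
    obtain ⟨r, hr, C, hC, h⟩ := hΩ.exists_arcDist_le_nhds hz
    refine ⟨Metric.ball z (r / 2), mem_nhdsWithin_of_mem_nhds
      (Metric.ball_mem_nhds z (by positivity)), r / 2, by positivity, max C 1, le_max_right _ _, ?_⟩
    intro x hx hxΓ y hy hxy
    have hx' : dist x z < r / 2 := hx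
    refine (h x hxΓ y hy (by linarith) ?_).trans ?_
    · linarith [dist_triangle_left y z x]
    · gcongr
      exact le_max_left _ _

/-! ### The quadrature rule on one boundary element -/

theorem quadNode_zero (S : Finset ℝ) : quadNode S 0 = 0 := by simp [quadNode]

theorem quadNode_card_succ (S : Finset ℝ) : quadNode S (S.card + 1) = 1 := by simp [quadNode]

theorem quadNode_of_mem {S : Finset ℝ} {k : ℕ} (hk : k ∈ Finset.Icc 1 S.card) :
    quadNode S k = S.orderEmbOfFin rfl ⟨k - 1, by have := Finset.mem_Icc.1 hk; omega⟩ := by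
  obtain ⟨h1, h2⟩ := Finset.mem_Icc.1 hk
  rw [quadNode, if_neg (by omega), dif_pos]

theorem quadNode_mem {S : Finset ℝ} {k : ℕ} (hk : k ∈ Finset.Icc 1 S.card) : quadNode S k ∈ S := by
  rw [quadNode_of_mem hk]
  exact Finset.orderEmbOfFin_mem _ _ _

theorem quadNode_lt {S : Finset ℝ} {j k : ℕ} (hj : 1 ≤ j) (hjk : j < k) (hk : k ≤ S.card) :
    quadNode S j < quadNode S k := by
  rw [quadNode_of_mem (Finset.mem_Icc.2 ⟨hj, by omega⟩),
    quadNode_of_mem (Finset.mem_Icc.2 ⟨by omega, hk⟩)]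
  exact (S.orderEmbOfFin rfl).strictMono (by simp only [Fin.mk_lt_mk]; omega)

theorem quadNode_le {S : Finset ℝ} {j k : ℕ} (hj : 1 ≤ j) (hjk : j ≤ k) (hk : k ≤ S.card) :
    quadNode S j ≤ quadNode S k := by
  rcases hjk.eq_or_lt with rfl | h
  · exact le_rfl
  · exact (quadNode_lt hj h hk).le

theorem exists_quadNode_eq {S : Finset ℝ} {s : ℝ} (hs : s ∈ S) :
    ∃ k ∈ Finset.Icc 1 S.card, quadNode S k = s := by
  have : s ∈ range (S.orderEmbOfFin rfl) := by rw [Finset.range_orderEmbOfFin]; exact hs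
  obtain ⟨i, rfl⟩ := this
  have hk : (i : ℕ) + 1 ∈ Finset.Icc 1 S.card := Finset.mem_Icc.2 ⟨by omega, i.2⟩
  exact ⟨i + 1, hk, by rw [quadNode_of_mem hk]; rfl⟩

theorem quadNode_one_le {S : Finset ℝ} {s : ℝ} (hs : s ∈ S) : quadNode S 1 ≤ s := by
  obtain ⟨k, hk, rfl⟩ := exists_quadNode_eq hs
  obtain ⟨h1, h2⟩ := Finset.mem_Icc.1 hk
  exact quadNode_le le_rfl h1 h2

theorem le_quadNode_card {S : Finset ℝ} {s : ℝ} (hs : s ∈ S) : s ≤ quadNode S S.card := by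
  obtain ⟨k, hk, rfl⟩ := exists_quadNode_eq hs
  obtain ⟨h1, h2⟩ := Finset.mem_Icc.1 hk
  exact quadNode_le h1 h2 le_rfl

theorem quadGap_nonneg {S : Finset ℝ} (hS : (S : Set ℝ) ⊆ Icc 0 1) (k : ℕ) : 0 ≤ quadGap S k := by
  have hmem : ∀ k, quadNode S k ∈ Icc (0 : ℝ) 1 := by
    intro k
    by_cases hk : k ∈ Finset.Icc 1 S.card
    · exact hS (quadNode_mem hk)
    · by_cases h0 : k = 0
      · subst h0; simp [quadNode_zero]
      · have : ¬ k - 1 < S.card := by rw [Finset.mem_Icc] at hk; omega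
        rw [quadNode, if_neg h0, dif_neg this]
        simp
  rw [quadGap, sub_nonneg]
  rcases Nat.lt_or_ge k 2 with h | h
  · interval_cases k
    · exact le_rfl
    · rw [quadNode_zero]; exact (hmem 1).1
  · rcases le_or_gt k S.card with h' | h'
    · exact quadNode_le (by omega) (by omega) h'
    · have : quadNode S k = 1 := by
        rw [quadNode, if_neg (by omega), dif_neg (by omega)]
      rw [this]
      exact (hmem _).2

/-- Each weight is the trapezoidal one plus the other half of an outer gap at each end. With a
single node the first and last cases would coincide and the formula would fail. -/
theorem quadWeight_eq {S : Finset ℝ} (h2 : 2 ≤ S.card) (k : ℕ) :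
    quadWeight S k = (quadGap S k + quadGap S (k + 1)) / 2
      + (if k = 1 then quadGap S 1 / 2 else 0)
      + (if k = S.card then quadGap S (S.card + 1) / 2 else 0) := by
  rw [quadWeight]
  by_cases h1 : k = 1
  · subst h1
    have : 1 ≠ S.card := by omega
    simp only [if_true, if_neg this]
    ring
  · by_cases hm : k = S.card
    · simp only [if_neg h1, ← hm, if_true]
      ring
    · simp [h1, hm]

theorem quadWeight_nonneg {S : Finset ℝ} (hS : (S : Set ℝ) ⊆ Icc 0 1) (h2 : 2 ≤ S.card) (k : ℕ) :
    0 ≤ quadWeight S k := by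
  have h := quadGap_nonneg hS
  have := h k
  have := h (k + 1)
  have := h 1
  have := h (S.card + 1)
  rw [quadWeight_eq h2]
  split_ifs <;> linarith

/-- The composite trapezoidal rule overestimates the integral of the square of an affine
function. -/
theorem integral_sq_le_trapezoid (t : ℕ → ℝ) (ht : ∀ k, 0 ≤ t (k + 1) - t k) (p q : ℝ) (m : ℕ) :
    (p ^ 2 * t (m + 1) + p * q * t (m + 1) ^ 2 + q ^ 2 * t (m + 1) ^ 3 / 3)
      - (p ^ 2 * t 1 + p * q * t 1 ^ 2 + q ^ 2 * t 1 ^ 3 / 3)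
      + (t (m + 2) - t (m + 1)) / 2 * (p + q * t (m + 1)) ^ 2 ≤
    ∑ k ∈ Finset.Icc 1 (m + 1),
      ((t k - t (k - 1)) + (t (k + 1) - t k)) / 2 * (p + q * t k) ^ 2 := by
  -- The brackets contain the antiderivative of `(p + q s)²`. The last term on the left is the half
  -- weight that the final node receives from the gap to its right, not yet integrated; keeping it
  -- closes the induction.
  induction m with
  | zero =>
    simp only [zero_add, Finset.Icc_self, Finset.sum_singleton, Nat.sub_self]
    nlinarith [mul_nonneg (ht 0) (sq_nonneg (p + q * t 1))]
  | succ m ih =>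
    rw [Finset.sum_Icc_succ_top (by omega)]
    -- One sixth of this is the exact trapezoidal error on the new gap.
    have h : 0 ≤ q ^ 2 * (t (m + 2) - t (m + 1)) ^ 3 := by
      have := ht (m + 1)
      positivity
    have e : m + 2 - 1 = m + 1 := rfl
    simp only [add_assoc, Nat.reduceAdd, e] at ih h ⊢
    linarith

/-- Lower bound for the quadrature rule on squares of affine functions, if the two outer gaps are
controlled by the first inner one. -/
theorem sq_add_sq_le_quad {S : Finset ℝ} (hS : (S : Set ℝ) ⊆ Icc 0 1) (h2 : 2 ≤ S.card) {D : ℝ}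
    (hD : 1 ≤ D) (hfirst : quadGap S 1 ≤ D * quadGap S 2)
    (hlast : quadGap S (S.card + 1) ≤ D * quadGap S 2) (p q : ℝ) :
    p ^ 2 + (p + q) ^ 2 ≤ 1296 * D ^ 3 *
      ∑ k ∈ Finset.Icc 1 S.card, quadWeight S k * (p + q * quadNode S k) ^ 2 := by
  obtain ⟨m, hm⟩ : ∃ m, S.card = m + 1 := ⟨S.card - 1, by omega⟩
  have hgap := quadGap_nonneg hS
  set a := quadNode S 1 with ha
  set b := quadNode S S.card with hb
  have haI : a ∈ Icc (0 : ℝ) 1 := hS (quadNode_mem (Finset.mem_Icc.2 ⟨le_rfl, by omega⟩))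
  have hbI : b ∈ Icc (0 : ℝ) 1 := hS (quadNode_mem (Finset.mem_Icc.2 ⟨by omega, le_rfl⟩))
  -- The interval `[0, 1]` is made up of the two outer gaps, each at most `D (b - a)`, and of `[a,
  -- b]`.
  have hlen : 1 ≤ 3 * D * (b - a) := by
    have e1 : quadGap S 1 = a := by simp [quadGap, quadNode_zero, ha]
    have e2 : quadGap S (S.card + 1) = 1 - b := by
      rw [quadGap, quadNode_card_succ, Nat.add_sub_cancel]
    have e3 : quadGap S 2 ≤ b - a := by
      have : quadNode S 2 ≤ b := quadNode_le (by omega) h2 le_rfl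
      rw [quadGap]
      exact sub_le_sub_right this _
    have e4 := hgap 2
    nlinarith
  have hsum : (p ^ 2 * b + p * q * b ^ 2 + q ^ 2 * b ^ 3 / 3)
      - (p ^ 2 * a + p * q * a ^ 2 + q ^ 2 * a ^ 3 / 3) ≤
      ∑ k ∈ Finset.Icc 1 S.card, quadWeight S k * (p + q * quadNode S k) ^ 2 := by
    have h1 := integral_sq_le_trapezoid (quadNode S) (fun k => hgap (k + 1)) p q m
    rw [← hm] at h1
    have h2' : 0 ≤ (quadNode S (m + 2) - b) / 2 * (p + q * b) ^ 2 := by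
      have : 0 ≤ quadNode S (m + 2) - b := by rw [hb, hm]; exact hgap (m + 2)
      positivity
    refine le_trans ?_ (h1.trans (Finset.sum_le_sum fun k _ => ?_))
    · linarith
    · refine mul_le_mul_of_nonneg_right ?_ (sq_nonneg _)
      have := hgap 1
      have := hgap (S.card + 1)
      rw [quadWeight_eq h2, quadGap, quadGap, Nat.add_sub_cancel]
      split_ifs <;> linarith
  refine le_trans ?_ (mul_le_mul_of_nonneg_left hsum (by positivity))
  obtain ⟨a0, a1⟩ := haI
  obtain ⟨b0, b1⟩ := hbI
  -- Expansion about the midpoint separates mean value and slope in the integral. The constant 1296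
  -- is `4 · 27 · 12`: the factor of `hp`, the cube of the length bound, and the denominator of the
  -- slope term.
  set M := p + q * ((a + b) / 2) with hM
  have hid : (p ^ 2 * b + p * q * b ^ 2 + q ^ 2 * b ^ 3 / 3)
      - (p ^ 2 * a + p * q * a ^ 2 + q ^ 2 * a ^ 3 / 3) =
      (b - a) * M ^ 2 + q ^ 2 * (b - a) ^ 3 / 12 := by rw [hM]; ring
  have hl0 : 0 < b - a := by
    by_contra hcon
    nlinarith
  have hl3 : 1 ≤ 27 * D ^ 3 * (b - a) ^ 3 := by
    have := one_le_pow₀ hlen (n := 3)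
    calc (1 : ℝ) ≤ _ := this
      _ = _ := by ring
  have hl1 : (b - a) ^ 3 ≤ b - a := by
    have : b - a ≤ 1 := by linarith
    calc (b - a) ^ 3 ≤ (b - a) ^ 1 := pow_le_pow_of_le_one hl0.le this (by norm_num)
      _ = b - a := pow_one _
  have hp : p ^ 2 + (p + q) ^ 2 ≤ 4 * (M ^ 2 + q ^ 2) := by
    have e1 : p = M - q * ((a + b) / 2) := by rw [hM]; ring
    have hc0 : 0 ≤ (a + b) / 2 := by linarith
    have hc1 : (a + b) / 2 ≤ 1 := by linarith
    set c := (a + b) / 2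
    rw [e1]
    nlinarith [sq_nonneg (M + q * c), sq_nonneg (M - q * (1 - c)),
      mul_nonneg (sq_nonneg q) (mul_nonneg hc0 (sub_nonneg.2 hc1)),
      mul_nonneg (sq_nonneg q) hc0]
  rw [hid]
  have h27 : 0 ≤ 27 * D ^ 3 := by positivity
  have hA : M ^ 2 + q ^ 2 ≤ 27 * D ^ 3 * ((b - a) ^ 3 * (M ^ 2 + q ^ 2)) := by
    have := mul_le_mul_of_nonneg_right hl3 (add_nonneg (sq_nonneg M) (sq_nonneg q))
    linarith
  have hB : (b - a) ^ 3 * (M ^ 2 + q ^ 2) ≤ 12 * ((b - a) * M ^ 2 + q ^ 2 * (b - a) ^ 3 / 12) := by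
    nlinarith [mul_le_mul_of_nonneg_right hl1 (sq_nonneg M), mul_nonneg hl0.le (sq_nonneg M)]
  have hC := mul_le_mul_of_nonneg_left hB h27
  linarith

/-! ### Shape regular triangles and gradients of piecewise affine functions -/

theorem Plane.volume_real_closedBall (x : Plane) {r : ℝ} (hr : 0 ≤ r) :
    volume.real (Metric.closedBall x r) = r ^ 2 * Real.pi := by
  rw [Measure.real, EuclideanSpace.volume_closedBall_fin_two]
  simp [hr, Real.pi_nonneg]

theorem Plane.volume_real_ball (x : Plane) {r : ℝ} (hr : 0 ≤ r) :
    volume.real (Metric.ball x r) = r ^ 2 * Real.pi := by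
  rw [Measure.real, EuclideanSpace.volume_ball_fin_two]
  simp [hr, Real.pi_nonneg]

namespace CurvedMesh

variable {Ω : Set Plane} (M : CurvedMesh Ω)

theorem affineSpan_tri {t : Finset Plane} (ht : t ∈ M.tri) : affineSpan ℝ (t : Set Plane) = ⊤ := by
  have h := (M.indep_tri t ht).affineSpan_eq_top_iff_card_eq_finrank_add_one
  have hr : range ((↑) : t → Plane) = (t : Set Plane) := Subtype.range_coe
  rw [hr] at h
  rw [h]
  simp [M.card_tri t ht]

theorem interior_tri_nonempty {t : Finset Plane} (ht : t ∈ M.tri) :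
    (interior (convexHull ℝ (t : Set Plane))).Nonempty :=
  interior_convexHull_nonempty_iff_affineSpan_eq_top.2 (M.affineSpan_tri ht)

theorem isCompact_tri (t : Finset Plane) : IsCompact (convexHull ℝ (t : Set Plane)) :=
  t.finite_toSet.isCompact_convexHull ℝ

/-- By conformity the intersection lies in the hull of the common vertices. If that hull had an
interior point there would be three common vertices, and the triangles would agree. -/
theorem disjoint_interior_tri {t t' : Finset Plane} (ht : t ∈ M.tri) (ht' : t' ∈ M.tri)
    (hne : t ≠ t') :
    Disjoint (interior (convexHull ℝ (t : Set Plane))) (interior (convexHull ℝ (t' : Set Plane))) := by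
  classical
  rw [Set.disjoint_iff_inter_eq_empty, ← interior_inter, ← not_nonempty_iff_eq_empty]
  intro hn
  have hsub := interior_mono (M.inter_tri t ht t' ht')
  have hn' := hn.mono hsub
  rw [interior_convexHull_nonempty_iff_affineSpan_eq_top, ← Finset.coe_inter] at hn'
  have hi : AffineIndependent ℝ ((↑) : (t ∩ t' : Finset Plane) → Plane) :=
    (M.indep_tri t ht).mono (Finset.coe_subset.2 Finset.inter_subset_left)
  have h := hi.affineSpan_eq_top_iff_card_eq_finrank_add_one
  have hr : range ((↑) : (t ∩ t' : Finset Plane) → Plane) = ((t ∩ t' : Finset Plane) : Set Plane) :=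
    Subtype.range_coe
  rw [hr] at h
  have hc : (t ∩ t').card = 3 := by simpa using h.1 hn'
  have h1 : t ∩ t' = t := Finset.eq_of_subset_of_card_le Finset.inter_subset_left
    (by rw [hc, M.card_tri t ht])
  have h2 : t ∩ t' = t' := Finset.eq_of_subset_of_card_le Finset.inter_subset_right
    (by rw [hc, M.card_tri t' ht'])
  exact hne (h1.symm.trans h2)

theorem Ωh_ae_eq :
    M.Ωh =ᵐ[volume] (⋃ t ∈ M.tri, interior (convexHull ℝ (t : Set Plane)) : Set Plane) := by
  refine (Filter.EventuallyLE.antisymm (LE.le.eventuallyLE ?_) ?_).symm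
  · exact iUnion₂_mono fun t _ => interior_subset
  · rw [ae_le_set]
    have hsub : M.Ωh \ (⋃ t ∈ M.tri, interior (convexHull ℝ (t : Set Plane))) ⊆
        ⋃ t ∈ M.tri, frontier (convexHull ℝ (t : Set Plane)) := by
      rintro x ⟨hx, hx'⟩
      obtain ⟨t, ht, hxt⟩ := mem_iUnion₂.1 hx
      refine mem_iUnion₂.2 ⟨t, ht, subset_closure hxt, fun hi => hx' (mem_iUnion₂.2 ⟨t, ht, hi⟩)⟩
    refine measure_mono_null hsub ?_
    refine (measure_biUnion_null_iff (μ := volume) M.tri.countable_toSet).2 fun t _ => ?_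
    exact (convex_convexHull ℝ _).addHaar_frontier volume

variable {M} in
theorem exists_affine (v : M.Vh) {t : Finset Plane} (ht : t ∈ M.tri) : ∃ a : Plane →ᵃ[ℝ] ℝ,
    ∀ x ∈ convexHull ℝ (t : Set Plane), zeroExt (v : C(M.Ωh, ℝ)) x = a x :=
  v.2 t ht

variable {M} in
theorem exists_slope (v : M.Vh) {t : Finset Plane} (ht : t ∈ M.tri) : ∃ g : Plane,
    ∀ x ∈ convexHull ℝ (t : Set Plane), ∀ y ∈ convexHull ℝ (t : Set Plane),
      zeroExt (v : C(M.Ωh, ℝ)) x - zeroExt (v : C(M.Ωh, ℝ)) y = inner ℝ g (x - y) := by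
  obtain ⟨a, ha⟩ := exists_affine v ht
  refine ⟨(InnerProductSpace.toDual ℝ Plane).symm (LinearMap.toContinuousLinearMap a.linear), ?_⟩
  intro x hx y hy
  rw [ha x hx, ha y hy, InnerProductSpace.toDual_symm_apply]
  exact (a.linearMap_vsub x y).symm

open Classical in
variable {M} in
/-- The constant gradient on the triangle `t` of a function in `V_h`. -/
noncomputable def slope (v : M.Vh) (t : Finset Plane) : Plane :=
  if ht : t ∈ M.tri then (exists_slope v ht).choose else 0

variable {M} in
theorem sub_eq_inner_slope (v : M.Vh) {t : Finset Plane} (ht : t ∈ M.tri) {x y : Plane}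
    (hx : x ∈ convexHull ℝ (t : Set Plane)) (hy : y ∈ convexHull ℝ (t : Set Plane)) :
    zeroExt (v : C(M.Ωh, ℝ)) x - zeroExt (v : C(M.Ωh, ℝ)) y = inner ℝ (slope v t) (x - y) := by
  rw [slope, dif_pos ht]
  exact (exists_slope v ht).choose_spec x hx y hy

variable {M} in
-- From an interior point one may step a little in the direction of the difference of two candidate
-- gradients, which forces that difference to vanish. Linearity of the slope follows.
theorem slope_unique (v : M.Vh) {t : Finset Plane} (ht : t ∈ M.tri) {g : Plane}
    (hg : ∀ x ∈ convexHull ℝ (t : Set Plane), ∀ y ∈ convexHull ℝ (t : Set Plane),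
      zeroExt (v : C(M.Ωh, ℝ)) x - zeroExt (v : C(M.Ωh, ℝ)) y = inner ℝ g (x - y)) :
    slope v t = g := by
  obtain ⟨c, hc⟩ := M.interior_tri_nonempty ht
  have hc' := interior_subset hc
  have hcont : ContinuousAt (fun ε : ℝ => c + ε • (slope v t - g)) 0 := by fun_prop
  have hev := hcont.preimage_mem_nhds (t := interior (convexHull ℝ (t : Set Plane)))
    (isOpen_interior.mem_nhds (by simpa using hc))
  obtain ⟨δ, hδ, hb⟩ := Metric.mem_nhds_iff.1 hev
  have hm : c + (δ / 2) • (slope v t - g) ∈ convexHull ℝ (t : Set Plane) :=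
    interior_subset (hb (a := δ / 2) (by
      rw [Metric.mem_ball, Real.dist_eq, sub_zero, abs_of_pos (half_pos hδ)]
      exact half_lt_self hδ))
  have h1 := sub_eq_inner_slope v ht hm hc'
  rw [hg _ hm _ hc', add_sub_cancel_left, inner_smul_right, inner_smul_right] at h1
  have h2 : inner ℝ (slope v t - g) (slope v t - g) = 0 := by
    rw [inner_sub_left]
    have : δ / 2 ≠ 0 := by positivity
    have := mul_left_cancel₀ this h1
    linarith
  exact sub_eq_zero.1 (inner_self_eq_zero.1 h2)

variable {M} in
theorem slope_add (u v : M.Vh) {t : Finset Plane} (ht : t ∈ M.tri) :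
    slope (u + v) t = slope u t + slope v t := by
  refine slope_unique _ ht fun x hx y hy => ?_
  rw [inner_add_left, ← sub_eq_inner_slope u ht hx hy, ← sub_eq_inner_slope v ht hx hy]
  simp only [Submodule.coe_add, zeroExt_add]
  ring

variable {M} in
theorem slope_smul (c : ℝ) (v : M.Vh) {t : Finset Plane} (ht : t ∈ M.tri) :
    slope (c • v) t = c • slope v t := by
  refine slope_unique _ ht fun x hx y hy => ?_
  rw [real_inner_smul_left, ← sub_eq_inner_slope v ht hx hy]
  simp only [Submodule.coe_smul, zeroExt_smul]
  ring

variable {M} in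
theorem gradient_eq_slope (v : M.Vh) {t : Finset Plane} (ht : t ∈ M.tri) {x : Plane}
    (hx : x ∈ interior (convexHull ℝ (t : Set Plane))) :
    gradient (zeroExt (v : C(M.Ωh, ℝ))) x = slope v t := by
  have hx' := interior_subset hx
  have h : HasGradientAt (fun y => zeroExt (v : C(M.Ωh, ℝ)) x +
      (inner ℝ (slope v t) y - inner ℝ (slope v t) x)) (slope v t) x := by
    rw [hasGradientAt_iff_hasFDerivAt]
    exact ((InnerProductSpace.toDual ℝ Plane (slope v t)).hasFDerivAt.sub_const _).const_add _
  refine (h.congr_of_eventuallyEq ?_).gradient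
  filter_upwards [isOpen_interior.mem_nhds hx] with y hy
  rw [← inner_sub_right, ← sub_eq_inner_slope v ht (interior_subset hy) hx']
  ring

/-- Edges are null sets and gradients are constant inside triangles. Bilinearity, positivity and the
energy bounds are all read off from this finite sum. -/
theorem gradInner_eq_sum (u v : M.Vh) : M.gradInner u v = ∑ t ∈ M.tri,
    volume.real (interior (convexHull ℝ (t : Set Plane))) *
      inner ℝ (slope u t) (slope v t) := by
  have heq : ∀ t ∈ M.tri, EqOn (fun x => inner ℝ (gradient (zeroExt (u : C(M.Ωh, ℝ))) x)
      (gradient (zeroExt (v : C(M.Ωh, ℝ))) x)) (fun _ => inner ℝ (slope u t) (slope v t))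
      (interior (convexHull ℝ (t : Set Plane))) := fun t ht x hx => by
    simp only [gradient_eq_slope u ht hx, gradient_eq_slope v ht hx]
  have hfin : ∀ t : Finset Plane, volume (interior (convexHull ℝ (t : Set Plane))) ≠ ⊤ := fun t =>
    ((measure_mono interior_subset).trans_lt (isCompact_tri t).measure_lt_top).ne
  rw [gradInner, setIntegral_congr_set M.Ωh_ae_eq, integral_biUnion_finset]
  · refine Finset.sum_congr rfl fun t ht => ?_
    rw [setIntegral_congr_fun isOpen_interior.measurableSet (heq t ht), setIntegral_const,
      smul_eq_mul]
  · exact fun t _ => isOpen_interior.measurableSet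
  · exact fun t ht t' ht' hne => M.disjoint_interior_tri ht ht' hne
  · intro t ht
    rw [integrableOn_congr_fun (heq t ht) isOpen_interior.measurableSet]
    exact integrableOn_const (hfin t)

theorem gradInner_comm (u v : M.Vh) : M.gradInner u v = M.gradInner v u := by
  simp only [gradInner, real_inner_comm]

theorem gradInner_add_left (u u' v : M.Vh) :
    M.gradInner (u + u') v = M.gradInner u v + M.gradInner u' v := by
  simp only [gradInner_eq_sum, ← Finset.sum_add_distrib]
  refine Finset.sum_congr rfl fun t ht => ?_
  rw [slope_add u u' ht, inner_add_left, mul_add]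

theorem gradInner_smul_left (c : ℝ) (u v : M.Vh) :
    M.gradInner (c • u) v = c * M.gradInner u v := by
  simp only [gradInner_eq_sum, Finset.mul_sum]
  refine Finset.sum_congr rfl fun t ht => ?_
  rw [slope_smul c u ht, real_inner_smul_left]
  ring

/-- `(∇u, ∇v)_{Ω_h}` as a bilinear form. -/
noncomputable def gradForm : M.Vh →ₗ[ℝ] M.Vh →ₗ[ℝ] ℝ :=
  LinearMap.mk₂ ℝ M.gradInner M.gradInner_add_left M.gradInner_smul_left
    (fun u v v' => by
      rw [M.gradInner_comm, M.gradInner_add_left, M.gradInner_comm v, M.gradInner_comm v'])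
    (fun c u v => by
      rw [M.gradInner_comm, M.gradInner_smul_left, M.gradInner_comm v, smul_eq_mul])

theorem gradForm_apply (u v : M.Vh) : M.gradForm u v = M.gradInner u v := rfl

theorem gradInner_self_nonneg (v : M.Vh) : 0 ≤ M.gradInner v v := by
  rw [gradInner_eq_sum]
  exact Finset.sum_nonneg fun t _ => mul_nonneg measureReal_nonneg real_inner_self_nonneg

theorem slope_eq_zero_of_gradInner_self {v : M.Vh} (h : M.gradInner v v = 0) {t : Finset Plane}
    (ht : t ∈ M.tri) : slope v t = 0 := by
  rw [gradInner_eq_sum, Finset.sum_eq_zero_iff_of_nonneg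
    fun t _ => mul_nonneg measureReal_nonneg real_inner_self_nonneg] at h
  rcases mul_eq_zero.1 (h t ht) with h0 | h0
  · exfalso
    have hpos := isOpen_interior.measure_pos volume (M.interior_tri_nonempty ht)
    have hlt : volume (interior (convexHull ℝ (t : Set Plane))) < ⊤ :=
      (measure_mono interior_subset).trans_lt (isCompact_tri t).measure_lt_top
    exact (ENNReal.toReal_pos hpos.ne' hlt.ne).ne' h0
  · exact inner_self_eq_zero.1 h0

/-- On a triangle, a function in `V_h` takes values in any convex set that contains its values at
the vertices. -/
theorem zeroExt_mem_of_vertices {M : CurvedMesh Ω} (v : M.Vh) {t : Finset Plane} (ht : t ∈ M.tri)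
    {s : Set ℝ} (hs : Convex ℝ s) (h : ∀ y ∈ t, zeroExt (v : C(M.Ωh, ℝ)) y ∈ s) {x : Plane}
    (hx : x ∈ convexHull ℝ (t : Set Plane)) : zeroExt (v : C(M.Ωh, ℝ)) x ∈ s := by
  obtain ⟨a, ha⟩ := exists_affine v ht
  have hsub : convexHull ℝ (t : Set Plane) ⊆ a ⁻¹' s := by
    refine convexHull_min (fun y hy => ?_) (hs.affine_preimage a)
    have := h y hy
    rwa [ha y (subset_convexHull ℝ _ hy)] at this
  rw [ha x hx]
  exact hsub hx

/-- Compare the values at the two ends of the diameter of the ball that points in the direction of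
the gradient. -/
theorem two_mul_radius_mul_norm_slope_le {M : CurvedMesh Ω} (v : M.Vh) {t : Finset Plane}
    (ht : t ∈ M.tri) {c : Plane} {r D : ℝ} (hr : 0 ≤ r)
    (hc : Metric.closedBall c r ⊆ convexHull ℝ (t : Set Plane))
    (hD : ∀ x ∈ convexHull ℝ (t : Set Plane), ∀ y ∈ convexHull ℝ (t : Set Plane),
      zeroExt (v : C(M.Ωh, ℝ)) x - zeroExt (v : C(M.Ωh, ℝ)) y ≤ D) :
    2 * r * ‖slope v t‖ ≤ D := by
  have hcc : c ∈ convexHull ℝ (t : Set Plane) := hc (Metric.mem_closedBall_self hr)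
  by_cases h0 : slope v t = 0
  · rw [h0, norm_zero, mul_zero]
    simpa using hD c hcc c hcc
  · have hn : 0 < ‖slope v t‖ := norm_pos_iff.2 h0
    have hnorm : ‖(r / ‖slope v t‖) • slope v t‖ = r := by
      rw [norm_smul, Real.norm_of_nonneg (by positivity)]
      field_simp
    have h1 : c + (r / ‖slope v t‖) • slope v t ∈ convexHull ℝ (t : Set Plane) :=
      hc (by rw [Metric.mem_closedBall, dist_self_add_left, hnorm])
    have h2 : c - (r / ‖slope v t‖) • slope v t ∈ convexHull ℝ (t : Set Plane) :=
      hc (by rw [Metric.mem_closedBall, dist_self_sub_left, hnorm])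
    have h3 := hD _ h1 _ h2
    rw [sub_eq_inner_slope v ht h1 h2, add_sub_sub_cancel, ← two_smul ℝ, real_inner_smul_right,
      real_inner_smul_right, real_inner_self_eq_norm_sq] at h3
    refine le_trans (le_of_eq ?_) h3
    field_simp

theorem diam_pos {M : CurvedMesh Ω} {t : Finset Plane} (ht : t ∈ M.tri) : 0 < hK t := by
  have hc : 1 < t.card := by rw [M.card_tri t ht]; norm_num
  obtain ⟨p, hp, q, hq, hne⟩ := Finset.one_lt_card.1 hc
  exact (dist_pos.2 hne).trans_le (Metric.dist_le_diam_of_mem (isCompact_tri t).isBounded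
    (subset_convexHull ℝ _ hp) (subset_convexHull ℝ _ hq))

/-- A ball of more than half the optimal diameter is enough, so the supremum need not be attained;
this doubles the constant to 4. -/
theorem exists_inscribed_ball {M : CurvedMesh Ω} {κ : ℝ} (hκ : 1 ≤ κ) (hM : M.IsRegular κ)
    {t : Finset Plane} (ht : t ∈ M.tri) :
    ∃ c r, 0 < r ∧ hK t ≤ 4 * κ * r ∧ Metric.closedBall c r ⊆ convexHull ℝ (t : Set Plane) := by
  have hpos := diam_pos ht
  have hsh := hM.shape t ht
  have hρ : 0 < ρK t := by
    by_contra h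
    nlinarith
  obtain ⟨p, hp⟩ : t.Nonempty := Finset.card_pos.1 (by rw [M.card_tri t ht]; norm_num)
  obtain ⟨d, ⟨c, r, hr, rfl, hc⟩, hd⟩ := exists_lt_of_lt_csSup (b := ρK t / 2)
    (s := {d : ℝ | ∃ (c : Plane) (r : ℝ), 0 ≤ r ∧ d = 2 * r ∧
      Metric.closedBall c r ⊆ convexHull ℝ (t : Set Plane)})
    ⟨0, p, 0, le_rfl, by simp, by simpa using subset_convexHull ℝ _ hp⟩
    (by change ρK t / 2 < ρK t; linarith)
  exact ⟨c, r, by linarith, by nlinarith, hc⟩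

theorem IsRegular.mono {M : CurvedMesh Ω} {κ κ' : ℝ} (h : κ ≤ κ') (hM : M.IsRegular κ) :
    M.IsRegular κ' where
  shape t ht := (hM.shape t ht).trans (mul_le_mul_of_nonneg_right h
    (Real.sSup_nonneg (by rintro _ ⟨c, r, hr, rfl, -⟩; positivity)))
  quasi_uniform t ht t' ht' :=
    (hM.quasi_uniform t ht t' ht').trans (mul_le_mul_of_nonneg_right h Metric.diam_nonneg)
  dF_le e he s hs := (hM.dF_le e he s hs).trans (mul_le_mul_of_nonneg_right h Metric.diam_nonneg)
  le_dF e he s hs := (hM.le_dF e he s hs).trans (mul_le_mul_of_nonneg_right h (norm_nonneg _))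

theorem hK_le_h {M : CurvedMesh Ω} {t : Finset Plane} (ht : t ∈ M.tri) : hK t ≤ M.h :=
  le_ciSup (f := fun t : M.tri => hK t.1) (finite_range _).bddAbove ⟨t, ht⟩

theorem h_le_mul_hK {M : CurvedMesh Ω} {κ : ℝ} (hM : M.IsRegular κ) {t : Finset Plane}
    (ht : t ∈ M.tri) : M.h ≤ κ * hK t := by
  have : Nonempty M.tri := ⟨⟨t, ht⟩⟩
  exact ciSup_le fun t' => hM.quasi_uniform t'.1 t'.2 t ht

theorem interp_apply (f : Plane → ℝ) {t : Finset Plane} (ht : t ∈ M.tri) {y : Plane} (hy : y ∈ t) :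
    zeroExt (M.interp f : C(M.Ωh, ℝ)) y = f y :=
  (M.existsUnique_interp f).exists.choose_spec t ht y hy

/-- The hat function of the vertex `q` oscillates by at most 1, so its gradient is at most the
inverse inscribed diameter; yet it changes by 1 along the edge `pq`, which therefore cannot be
short. -/
theorem hK_le_mul_dist {M : CurvedMesh Ω} {κ : ℝ} (hκ : 1 ≤ κ) (hM : M.IsRegular κ)
    {t : Finset Plane} (ht : t ∈ M.tri) {p q : Plane} (hp : p ∈ t) (hq : q ∈ t) (hne : p ≠ q) :
    hK t ≤ 2 * κ * dist p q := by
  classical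
  obtain ⟨c, r, hr, hKr, hc⟩ := exists_inscribed_ball hκ hM ht
  let v := M.interp fun y => if y = q then 1 else 0
  have hv : ∀ x ∈ convexHull ℝ (t : Set Plane), zeroExt (v : C(M.Ωh, ℝ)) x ∈ Icc (0 : ℝ) 1 := by
    intro x hx
    refine zeroExt_mem_of_vertices v ht (convex_Icc 0 1) (fun y hy => ?_) hx
    rw [M.interp_apply _ ht hy]
    split_ifs <;> simp
  have h1 : 2 * r * ‖slope v t‖ ≤ 1 := two_mul_radius_mul_norm_slope_le v ht hr.le hc
    fun x hx y hy => by linarith [(hv x hx).2, (hv y hy).1]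
  have h2 := sub_eq_inner_slope v ht (subset_convexHull ℝ _ hq) (subset_convexHull ℝ _ hp)
  rw [M.interp_apply _ ht hq, M.interp_apply _ ht hp, if_pos rfl, if_neg hne, sub_zero] at h2
  have h3 : (1 : ℝ) ≤ ‖slope v t‖ * dist p q := by
    rw [h2, dist_comm, dist_eq_norm]
    exact real_inner_le_norm _ _
  have h4 : 2 * r ≤ dist p q := by
    have := mul_le_mul_of_nonneg_right h1 (dist_nonneg (x := p) (y := q))
    nlinarith
  nlinarith

/-- The Dirichlet energy is scale invariant in the plane: the area is at most `π h_K²`, the gradient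
at most `m / r`, and shape regularity cancels `h_K` against `r`. -/
theorem area_mul_norm_slope_sq_le {M : CurvedMesh Ω} {κ : ℝ} (hκ : 1 ≤ κ) (hM : M.IsRegular κ)
    (v : M.Vh) {t : Finset Plane} (ht : t ∈ M.tri) :
    volume.real (interior (convexHull ℝ (t : Set Plane))) * ‖slope v t‖ ^ 2 ≤
      16 * Real.pi * κ ^ 2 * ∑ y ∈ t, zeroExt (v : C(M.Ωh, ℝ)) y ^ 2 := by
  obtain ⟨c, r, hr, hKr, hc⟩ := exists_inscribed_ball hκ hM ht
  set m := Real.sqrt (∑ y ∈ t, zeroExt (v : C(M.Ωh, ℝ)) y ^ 2) with hm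
  have hm2 : m ^ 2 = ∑ y ∈ t, zeroExt (v : C(M.Ωh, ℝ)) y ^ 2 :=
    Real.sq_sqrt (Finset.sum_nonneg fun _ _ => sq_nonneg _)
  have hv : ∀ x ∈ convexHull ℝ (t : Set Plane), zeroExt (v : C(M.Ωh, ℝ)) x ∈ Icc (-m) m := by
    intro x hx
    refine zeroExt_mem_of_vertices v ht (convex_Icc _ _) (fun y hy => ?_) hx
    refine abs_le.1 (Real.abs_le_sqrt ?_)
    exact Finset.single_le_sum (f := fun y => zeroExt (v : C(M.Ωh, ℝ)) y ^ 2)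
      (fun _ _ => sq_nonneg _) hy
  have h1 : 2 * r * ‖slope v t‖ ≤ 2 * m := two_mul_radius_mul_norm_slope_le v ht hr.le hc
    fun x hx y hy => by linarith [(hv x hx).2, (hv y hy).1]
  have h2 : r ^ 2 * ‖slope v t‖ ^ 2 ≤ m ^ 2 := by
    rw [← mul_pow]
    exact pow_le_pow_left₀ (by positivity) (by linarith) 2
  have harea : volume.real (interior (convexHull ℝ (t : Set Plane))) ≤ hK t ^ 2 * Real.pi := by
    rw [← Plane.volume_real_closedBall c (diam_pos ht).le]
    refine measureReal_mono (fun x hx => ?_) measure_closedBall_lt_top.ne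
    exact Metric.dist_le_diam_of_mem (isCompact_tri t).isBounded (interior_subset hx)
      (hc (Metric.mem_closedBall_self hr.le))
  have h3 : hK t ^ 2 ≤ 16 * κ ^ 2 * r ^ 2 := by
    calc hK t ^ 2 ≤ (4 * κ * r) ^ 2 := pow_le_pow_left₀ (diam_pos ht).le hKr 2
      _ = _ := by ring
  rw [← hm2]
  calc _ ≤ hK t ^ 2 * Real.pi * ‖slope v t‖ ^ 2 := by gcongr
    _ ≤ 16 * κ ^ 2 * r ^ 2 * Real.pi * ‖slope v t‖ ^ 2 := by
        have := Real.pi_pos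
        gcongr
    _ = 16 * Real.pi * κ ^ 2 * (r ^ 2 * ‖slope v t‖ ^ 2) := by ring
    _ ≤ _ := by
        have := Real.pi_pos
        gcongr

open Classical in
/-- The number of triangles that share a vertex is bounded. -/
theorem card_triangles_at_le {M : CurvedMesh Ω} {κ : ℝ} (hκ : 1 ≤ κ) (hM : M.IsRegular κ)
    (y : Plane) : ((M.tri.filter fun t => y ∈ t).card : ℝ) ≤ 16 * κ ^ 4 := by
  set T := M.tri.filter fun t => y ∈ t with hT
  rcases T.eq_empty_or_nonempty with h0 | ⟨t₀, ht₀⟩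
  · rw [h0, Finset.card_empty, Nat.cast_zero]
    positivity
  have hTm : ∀ t ∈ T, t ∈ M.tri ∧ y ∈ t := fun t ht => Finset.mem_filter.1 ht
  have hpos : 0 < M.h := (diam_pos (hTm t₀ ht₀).1).trans_le (hK_le_h (hTm t₀ ht₀).1)
  -- Area count: the interiors are disjoint, lie in the ball of radius `h` about `y`, and each
  -- contains a disc of radius at least `h / (4 κ²)`.
  have hunion : volume.real (⋃ t ∈ T, interior (convexHull ℝ (t : Set Plane))) =
      ∑ t ∈ T, volume.real (interior (convexHull ℝ (t : Set Plane))) := by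
    refine measureReal_biUnion_finset ?_ (fun t _ => isOpen_interior.measurableSet) fun t _ =>
      ((measure_mono interior_subset).trans_lt (isCompact_tri t).measure_lt_top).ne
    exact fun t ht t' ht' hne => M.disjoint_interior_tri (hTm t ht).1 (hTm t' ht').1 hne
  have hup : volume.real (⋃ t ∈ T, interior (convexHull ℝ (t : Set Plane))) ≤
      M.h ^ 2 * Real.pi := by
    rw [← Plane.volume_real_closedBall y hpos.le]
    refine measureReal_mono (iUnion₂_subset fun t ht x hx => ?_) measure_closedBall_lt_top.ne
    exact (Metric.dist_le_diam_of_mem (isCompact_tri t).isBounded (interior_subset hx)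
      (subset_convexHull ℝ _ (hTm t ht).2)).trans (hK_le_h (hTm t ht).1)
  have hlow : ∀ t ∈ T, M.h ^ 2 * Real.pi / (16 * κ ^ 4) ≤
      volume.real (interior (convexHull ℝ (t : Set Plane))) := by
    intro t ht
    obtain ⟨c, r, hr, hKr, hc⟩ := exists_inscribed_ball hκ hM (hTm t ht).1
    have h1 : M.h ≤ 4 * κ ^ 2 * r := by
      have := h_le_mul_hK hM (hTm t ht).1
      nlinarith
    have h2 : M.h ^ 2 ≤ 16 * κ ^ 4 * r ^ 2 := by
      calc M.h ^ 2 ≤ (4 * κ ^ 2 * r) ^ 2 := pow_le_pow_left₀ hpos.le h1 2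
        _ = _ := by ring
    rw [div_le_iff₀ (by positivity)]
    calc M.h ^ 2 * Real.pi ≤ 16 * κ ^ 4 * r ^ 2 * Real.pi := by
          have := Real.pi_pos
          gcongr
      _ = r ^ 2 * Real.pi * (16 * κ ^ 4) := by ring
      _ ≤ _ := by
          rw [← Plane.volume_real_ball c hr.le]
          gcongr
          · exact ((measure_mono interior_subset).trans_lt (isCompact_tri t).measure_lt_top).ne
          · exact interior_maximal (Metric.ball_subset_closedBall.trans hc) Metric.isOpen_ball
  have hsum := Finset.card_nsmul_le_sum T _ _ hlow
  rw [nsmul_eq_mul, ← hunion] at hsum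
  have := hsum.trans hup
  have hpi := Real.pi_pos
  rw [mul_div_assoc', div_le_iff₀ (by positivity)] at this
  have h5 : 0 < M.h ^ 2 * Real.pi := by positivity
  nlinarith

theorem gradInner_self_le {M : CurvedMesh Ω} {κ : ℝ} (hκ : 1 ≤ κ) (hM : M.IsRegular κ)
    (v : M.Vh) : M.gradInner v v ≤
      16 * Real.pi * κ ^ 2 * ∑ t ∈ M.tri, ∑ y ∈ t, zeroExt (v : C(M.Ωh, ℝ)) y ^ 2 := by
  rw [gradInner_eq_sum, Finset.mul_sum]
  refine Finset.sum_le_sum fun t ht => ?_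
  rw [real_inner_self_eq_norm_sq]
  exact area_mul_norm_slope_sq_le hκ hM v ht

end CurvedMesh

/-! ### Boundary elements and lower bounds for arc length distance -/

/-- An injective continuous path is uniformly expanding away from the diagonal. -/
theorem exists_abs_sub_lt_of_dist_lt {F : ℝ → Plane} (hF : ContinuousOn F (Icc 0 1))
    (hinj : InjOn F (Icc 0 1)) {ε : ℝ} (hε : 0 < ε) :
    ∃ η > 0, ∀ t ∈ Icc (0 : ℝ) 1, ∀ t' ∈ Icc (0 : ℝ) 1, dist (F t) (F t') < η → |t - t'| < ε := by
  let P : Set (ℝ × ℝ) := (Icc 0 1 ×ˢ Icc 0 1) ∩ {p | ε ≤ |p.1 - p.2|}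
  have hP : IsCompact P := (isCompact_Icc.prod isCompact_Icc).inter_right
    (isClosed_le continuous_const (by fun_prop))
  have hcont : ContinuousOn (fun p : ℝ × ℝ => dist (F p.1) (F p.2)) P := by
    have h1 : ContinuousOn (fun p : ℝ × ℝ => F p.1) P :=
      hF.comp continuousOn_fst fun p hp => hp.1.1
    have h2 : ContinuousOn (fun p : ℝ × ℝ => F p.2) P :=
      hF.comp continuousOn_snd fun p hp => hp.1.2
    exact continuous_dist.comp_continuousOn (h1.prodMk h2)
  rcases P.eq_empty_or_nonempty with h0 | hne
  · refine ⟨1, one_pos, fun t ht t' ht' _ => ?_⟩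
    by_contra hcon
    exact (h0 ▸ (⟨⟨ht, ht'⟩, not_lt.1 hcon⟩ : (t, t') ∈ P) : (t, t') ∈ (∅ : Set (ℝ × ℝ)))
  · obtain ⟨q, hq, hmin⟩ := hP.exists_isMinOn hne hcont
    refine ⟨dist (F q.1) (F q.2), dist_pos.2 fun h => ?_, fun t ht t' ht' hlt => ?_⟩
    · have := hinj hq.1.1 hq.1.2 h
      have h2 : ε ≤ |q.1 - q.2| := hq.2
      rw [this, sub_self, abs_zero] at h2
      exact hε.not_ge h2
    · by_contra hcon
      have := hmin (⟨⟨ht, ht'⟩, not_lt.1 hcon⟩ : (t, t') ∈ P)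
      exact hlt.not_ge this

/-- A smooth path with speed at least `c` is locally expanding by the factor `c / 2`. -/
theorem exists_mul_abs_sub_le_dist {F : ℝ → Plane} (hF : ContDiffOn ℝ ∞ F (Icc 0 1)) {c : ℝ}
    (hc : 0 < c) (hle : ∀ s ∈ Icc (0 : ℝ) 1, c ≤ ‖derivWithin F (Icc 0 1) s‖) :
    ∃ δ > 0, ∀ s ∈ Icc (0 : ℝ) 1, ∀ t ∈ Icc (0 : ℝ) 1, |s - t| < δ →
      c / 2 * |s - t| ≤ dist (F s) (F t) := by
  have hd : ContinuousOn (derivWithin F (Icc 0 1)) (Icc 0 1) :=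
    hF.continuousOn_derivWithin (uniqueDiffOn_Icc zero_lt_one) (by simp)
  have hdiff : DifferentiableOn ℝ F (Icc 0 1) := hF.differentiableOn (by simp)
  have hu := isCompact_Icc.uniformContinuousOn_of_continuous hd
  obtain ⟨δ, hδ, h⟩ := Metric.uniformContinuousOn_iff.1 hu (c / 2) (by positivity)
  refine ⟨δ, hδ, fun s hs t ht hst => ?_⟩
  set w := derivWithin F (Icc 0 1) s with hw
  have hsub : uIcc s t ⊆ Icc 0 1 := uIcc_subset_Icc hs ht
  -- Subtracting the linear part at `s` leaves a function with derivative at most `c / 2`, by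
  -- uniform continuity of the derivative.
  have hmv := (convex_uIcc s t).norm_image_sub_le_of_norm_hasDerivWithin_le
    (f := fun x => F x - x • w) (f' := fun x => derivWithin F (Icc 0 1) x - w) (C := c / 2)
    (x := s) (y := t) ?_ ?_ left_mem_uIcc right_mem_uIcc
  · have e1 : F t - t • w - (F s - s • w) = (F t - F s) - (t - s) • w := by
      rw [sub_smul]; abel
    rw [e1] at hmv
    have h1 : ‖(t - s) • w‖ ≤ ‖(F t - F s) - (t - s) • w‖ + ‖F t - F s‖ := by
      calc ‖(t - s) • w‖ = ‖(F t - F s) - ((F t - F s) - (t - s) • w)‖ := by congr 1; abel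
        _ ≤ ‖F t - F s‖ + ‖(F t - F s) - (t - s) • w‖ := norm_sub_le _ _
        _ = _ := add_comm _ _
    rw [norm_smul, Real.norm_eq_abs] at h1
    rw [Real.norm_eq_abs] at hmv
    have h2 := mul_le_mul_of_nonneg_left (hle s hs) (abs_nonneg (t - s))
    rw [dist_comm, dist_eq_norm, abs_sub_comm s t]
    nlinarith
  · intro x hx
    have h1 := ((hdiff x (hsub hx)).hasDerivWithinAt.mono hsub)
    have h2 := ((hasDerivWithinAt_id x (uIcc s t)).smul_const w)
    rw [one_smul] at h2
    exact h1.sub h2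
  · intro x hx
    rw [← dist_eq_norm]
    refine (h x (hsub hx) s hs ?_).le
    rw [Real.dist_eq, abs_sub_comm s t] at *
    exact (abs_sub_left_of_mem_uIcc hx).trans_lt hst

/-- Length of a path that lifts through a locally expanding parametrization. -/
theorem ofReal_le_eVariationOn_of_lift {F γ : ℝ → Plane} {σ : ℝ → ℝ} {c η b : ℝ} (hη : 0 < η)
    (hc : 0 ≤ c) (hb : 0 ≤ b)
    (hF : ∀ t ∈ Icc (0 : ℝ) 1, ∀ t' ∈ Icc (0 : ℝ) 1, dist (F t) (F t') < η →
      c * |t - t'| ≤ dist (F t) (F t'))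
    (hγ : ContinuousOn γ (Icc 0 b)) (hσ : ∀ s ∈ Icc 0 b, σ s ∈ Icc (0 : ℝ) 1)
    (hFσ : ∀ s ∈ Icc 0 b, F (σ s) = γ s) :
    ENNReal.ofReal (c * |σ b - σ 0|) ≤ eVariationOn γ (Icc 0 b) := by
  have hu := isCompact_Icc.uniformContinuousOn_of_continuous hγ
  obtain ⟨ζ, hζ, h⟩ := Metric.uniformContinuousOn_iff.1 hu η hη
  obtain ⟨N, hN⟩ := exists_nat_gt (b / ζ)
  have hN0 : (0 : ℝ) < N := lt_of_le_of_lt (by positivity) hN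
  -- An equidistant subdivision so fine that `γ` moves by less than `η` per step, which makes the
  -- local expansion available on each step; no continuity of `σ` is needed. The sequence is frozen
  -- at `b` beyond `N` to remain monotone within `[0, b]`.
  let u : ℕ → ℝ := fun i => b * (min i N : ℕ) / N
  have hmono : Monotone u := fun i j hij => by
    have : min i N ≤ min j N := min_le_min_right _ hij
    simp only [u]
    gcongr
  have humem : ∀ i, u i ∈ Icc 0 b := by
    intro i
    refine ⟨by positivity, ?_⟩
    rw [div_le_iff₀ hN0]
    gcongr
    exact min_le_right _ _
  have hstep : ∀ i ∈ Finset.range N, |u (i + 1) - u i| < ζ := by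
    intro i hi
    have hi' := Finset.mem_range.1 hi
    have : u (i + 1) - u i = b / N := by
      simp only [u, min_eq_left (Nat.succ_le_of_lt hi'), min_eq_left hi'.le]
      push_cast
      ring
    rw [this, abs_of_nonneg (by positivity), div_lt_iff₀ hN0]
    rw [div_lt_iff₀ hζ] at hN
    linarith
  have h0 : u 0 = 0 := by simp [u]
  have h1 : u N = b := by simp only [u, min_self]; field_simp
  refine le_trans ?_ (eVariationOn.sum_le (f := γ) (n := N) hmono humem)
  calc ENNReal.ofReal (c * |σ b - σ 0|)
      ≤ ENNReal.ofReal (∑ i ∈ Finset.range N, c * |σ (u (i + 1)) - σ (u i)|) := by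
        rw [← Finset.mul_sum]
        gcongr
        rw [← h0, ← h1, ← Real.dist_eq, dist_comm]
        refine (dist_le_range_sum_dist (fun i => σ (u i)) N).trans (le_of_eq ?_)
        exact Finset.sum_congr rfl fun i _ => by rw [dist_comm, Real.dist_eq]
    _ = ∑ i ∈ Finset.range N, ENNReal.ofReal (c * |σ (u (i + 1)) - σ (u i)|) :=
        ENNReal.ofReal_sum_of_nonneg fun i _ => by positivity
    _ ≤ _ := by
        refine Finset.sum_le_sum fun i hi => ?_
        rw [edist_dist]
        refine ENNReal.ofReal_le_ofReal ?_
        rw [← hFσ _ (humem _), ← hFσ _ (humem _)]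
        refine hF _ (hσ _ (humem _)) _ (hσ _ (humem _)) ?_
        rw [hFσ _ (humem _), hFσ _ (humem _)]
        exact h _ (humem _) _ (humem _) (by rw [Real.dist_eq]; exact hstep i hi)

namespace CurvedMesh

variable {Ω : Set Plane} {M : CurvedMesh Ω}

theorem F_continuousOn {e : Finset Plane} (he : e ∈ M.bd) : ContinuousOn (M.F e) (Icc 0 1) :=
  (M.F_smooth e he).continuousOn

theorem chord_mem {e : Finset Plane} (he : e ∈ M.bd) {s : ℝ} (hs : s ∈ Icc (0 : ℝ) 1) :
    AffineMap.lineMap (M.F e 0) (M.F e 1) s ∈ convexHull ℝ (e : Set Plane) :=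
  M.lineMap_mem he Finset.Subset.rfl hs

theorem chord_mem_Ωh {e : Finset Plane} (he : e ∈ M.bd) {s : ℝ} (hs : s ∈ Icc (0 : ℝ) 1) :
    AffineMap.lineMap (M.F e 0) (M.F e 1) s ∈ M.Ωh := by
  obtain ⟨t, ht, het⟩ := M.bd_sub e he
  exact M.mem_Ωh ht (M.lineMap_mem he het hs)

/-- Since `Φ` is injective and preserves parameters from chord to arc, incidences of curved elements
reduce to incidences of straight edges. -/
theorem chord_eq_of_F_eq {e e' : Finset Plane} (he : e ∈ M.bd) (he' : e' ∈ M.bd) {s s' : ℝ}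
    (hs : s ∈ Icc (0 : ℝ) 1) (hs' : s' ∈ Icc (0 : ℝ) 1) (h : M.F e s = M.F e' s') :
    (AffineMap.lineMap (M.F e 0) (M.F e 1) s : Plane) =
      AffineMap.lineMap (M.F e' 0) (M.F e' 1) s' := by
  refine M.Φ_inj (chord_mem_Ωh he hs) (chord_mem_Ωh he' hs') ?_
  rw [M.Φ_bd e he s hs, M.Φ_bd e' he' s' hs', h]

theorem F_injOn {e : Finset Plane} (he : e ∈ M.bd) : InjOn (M.F e) (Icc 0 1) := by
  intro s hs s' hs' h
  exact AffineMap.lineMap_injective ℝ (M.bd_ne e he) (chord_eq_of_F_eq he he hs hs' h)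

theorem bd_eq_pair [DecidableEq Plane] {e : Finset Plane} (he : e ∈ M.bd) :
    e = {M.F e 0, M.F e 1} := by
  rw [← Finset.coe_inj, M.bd_ends e he]
  simp

theorem card_bd {e : Finset Plane} (he : e ∈ M.bd) : e.card = 2 := by
  classical
  rw [bd_eq_pair he, Finset.card_pair (M.bd_ne e he)]

/-- Conformity puts a common point into the hull of the common vertices of the two triangles. Faces
of a simplex intersect in the hull of their common vertices; this is applied once in each triangle.
-/
theorem convexHull_inter_bd [DecidableEq Plane] {e e' : Finset Plane} (he : e ∈ M.bd)
    (he' : e' ∈ M.bd) :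
    convexHull ℝ (e : Set Plane) ∩ convexHull ℝ (e' : Set Plane) ⊆
      convexHull ℝ ((e ∩ e' : Finset Plane) : Set Plane) := by
  rintro x ⟨hx, hx'⟩
  obtain ⟨t, ht, het⟩ := M.bd_sub e he
  obtain ⟨t', ht', het'⟩ := M.bd_sub e' he'
  have h1 := M.inter_tri t ht t' ht' ⟨convexHull_mono (Finset.coe_subset.2 het) hx,
    convexHull_mono (Finset.coe_subset.2 het') hx'⟩
  rw [← Finset.coe_inter] at h1
  have h2 := (M.indep_tri t ht).convexHull_inter het Finset.inter_subset_left (t₂ := t ∩ t')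
  have h3 : x ∈ convexHull ℝ ((e : Set Plane) ∩ (t ∩ t' : Finset Plane)) := by
    rw [h2]; exact ⟨hx, h1⟩
  rw [← Finset.coe_inter] at h3
  have h4 := (M.indep_tri t' ht').convexHull_inter
    (Finset.inter_subset_right.trans Finset.inter_subset_right : e ∩ (t ∩ t') ⊆ t') het'
  have h5 : x ∈ convexHull ℝ (((e ∩ (t ∩ t') : Finset Plane) : Set Plane) ∩ (e' : Set Plane)) := by
    rw [h4]; exact ⟨h3, hx'⟩
  refine convexHull_mono ?_ h5
  rw [← Finset.coe_inter]
  exact Finset.coe_subset.2 (Finset.inter_subset_inter_right Finset.inter_subset_left)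

/-- Different boundary elements meet only in end points. -/
theorem eq_zero_or_one_of_F_eq {e e' : Finset Plane} (he : e ∈ M.bd) (he' : e' ∈ M.bd)
    (hne : e ≠ e') {s s' : ℝ} (hs : s ∈ Icc (0 : ℝ) 1) (hs' : s' ∈ Icc (0 : ℝ) 1)
    (h : M.F e s = M.F e' s') : s = 0 ∨ s = 1 := by
  classical
  have hinj := AffineMap.lineMap_injective ℝ (M.bd_ne e he)
  have hx : (AffineMap.lineMap (M.F e 0) (M.F e 1) s : Plane) ∈
      convexHull ℝ ((e ∩ e' : Finset Plane) : Set Plane) := by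
    refine convexHull_inter_bd he he' ⟨chord_mem he hs, ?_⟩
    rw [chord_eq_of_F_eq he he' hs hs' h]
    exact chord_mem he' hs'
  have hcard : (e ∩ e').card ≤ 1 := by
    by_contra hcon
    have h1 : e ∩ e' = e := Finset.eq_of_subset_of_card_le Finset.inter_subset_left
      (by rw [card_bd he]; omega)
    have h2 : e ∩ e' = e' := Finset.eq_of_subset_of_card_le Finset.inter_subset_right
      (by rw [card_bd he']; omega)
    exact hne (h1.symm.trans h2)
  have hn : (e ∩ e').Nonempty := by
    rw [Finset.nonempty_iff_ne_empty]
    intro h0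
    simp [h0] at hx
  obtain ⟨y, hy⟩ := Finset.card_eq_one.1 (le_antisymm hcard hn.card_pos)
  rw [hy, Finset.coe_singleton, convexHull_singleton, mem_singleton_iff] at hx
  have hye : y ∈ (e : Set Plane) := Finset.inter_subset_left (hy ▸ Finset.mem_singleton_self y)
  rw [M.bd_ends e he] at hye
  rcases hye with h0 | h1
  · left
    refine hinj (hx.trans ?_)
    rw [h0, AffineMap.lineMap_apply_zero]
  · right
    refine hinj (hx.trans ?_)
    rw [h1, AffineMap.lineMap_apply_one]

/-- The complement in the boundary of an open part of a boundary element is closed. -/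
theorem exists_isClosed_compl_image_Ioo {e : Finset Plane} (he : e ∈ M.bd) {a b : ℝ} (ha : 0 ≤ a)
    (hb : b ≤ 1) : ∃ K : Set Plane, IsClosed K ∧ frontier Ω ⊆ M.F e '' Ioo a b ∪ K ∧
      Disjoint (M.F e '' Ioo a b) K := by
  classical
  have hcl : ∀ e ∈ M.bd, ∀ a b, 0 ≤ a → b ≤ 1 → IsClosed (M.F e '' Icc a b) :=
    fun e he a b ha hb =>
      (isCompact_Icc.image_of_continuousOn ((F_continuousOn he).mono (Icc_subset_Icc ha hb))).isClosed
  have hIoo : ∀ {s}, s ∈ Ioo a b → s ∈ Icc (0 : ℝ) 1 :=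
    fun hs => ⟨ha.trans hs.1.le, hs.2.le.trans hb⟩
  by_cases hab : a < b
  swap
  · exact ⟨univ, isClosed_univ, by simp, by simp [Ioo_eq_empty hab]⟩
  -- The closed set consists of the two remaining pieces of the element and all other elements.
  refine ⟨M.F e '' Icc 0 a ∪ M.F e '' Icc b 1 ∪ ⋃ e' ∈ M.bd.erase e, M.F e' '' Icc 0 1,
    ((hcl e he _ _ le_rfl (hab.le.trans hb)).union (hcl e he _ _ (ha.trans hab.le) le_rfl)).union
      ((M.bd.erase e).finite_toSet.isClosed_biUnion fun e' he' =>
        hcl e' (Finset.mem_of_mem_erase he') _ _ le_rfl le_rfl), ?_, ?_⟩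
  · rw [← M.bd_cover]
    refine iUnion₂_subset fun e' he' => ?_
    rintro _ ⟨s, hs, rfl⟩
    by_cases hee : e' = e
    · subst hee
      rcases le_or_gt s a with h | h
      · exact Or.inr (Or.inl (Or.inl ⟨s, ⟨hs.1, h⟩, rfl⟩))
      · rcases le_or_gt b s with h' | h'
        · exact Or.inr (Or.inl (Or.inr ⟨s, ⟨h', hs.2⟩, rfl⟩))
        · exact Or.inl ⟨s, ⟨h, h'⟩, rfl⟩
    · exact Or.inr (Or.inr (mem_iUnion₂.2 ⟨e', Finset.mem_erase.2 ⟨hee, he'⟩, s, hs, rfl⟩))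
  · rw [Set.disjoint_left]
    rintro _ ⟨s, hs, rfl⟩ ((⟨s', hs', h⟩ | ⟨s', hs', h⟩) | h)
    · have := F_injOn he ⟨hs'.1, hs'.2.trans (hab.le.trans hb)⟩ (hIoo hs) h
      exact absurd hs'.2 (not_le.2 (this ▸ hs.1))
    · have := F_injOn he ⟨(ha.trans hab.le).trans hs'.1, hs'.2⟩ (hIoo hs) h
      exact absurd hs'.1 (not_le.2 (this ▸ hs.2))
    · obtain ⟨e', he', s', hs', h⟩ := mem_iUnion₂.1 h
      obtain ⟨hne, he'⟩ := Finset.mem_erase.1 he'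
      rcases eq_zero_or_one_of_F_eq he he' (Ne.symm hne) (hIoo hs) hs' h.symm with h0 | h1
      · exact absurd hs.1 (by rw [h0]; exact not_lt.2 ha)
      · exact absurd hs.2 (by rw [h1]; exact not_lt.2 hb)

/-- A path in the boundary that leaves an open part of a boundary element has a length bounded
from below. -/
theorem le_arcDist_of_not_mem_image_Ioo {e : Finset Plane} (he : e ∈ M.bd) {c : ℝ} (hc : 0 < c)
    (hle : ∀ s ∈ Icc (0 : ℝ) 1, c ≤ ‖M.dF e s‖) {a b m : ℝ} (ha : 0 ≤ a) (hb : b ≤ 1)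
    (hm : m ∈ Ioo a b) {y : Plane} (hy : y ∉ M.F e '' Ioo a b) :
    ENNReal.ofReal (c / 2 * min (m - a) (b - m)) ≤ arcDist (frontier Ω) (M.F e m) y := by
  obtain ⟨K, hK, hcover, hdisj⟩ := exists_isClosed_compl_image_Ioo he ha hb
  obtain ⟨δ, hδ, hloc⟩ := exists_mul_abs_sub_le_dist (M.F_smooth e he) hc hle
  obtain ⟨η, hη, hunif⟩ := exists_abs_sub_lt_of_dist_lt (F_continuousOn he) (F_injOn he) hδ
  refine le_iInf₂ fun γ => ?_
  rintro ⟨hγ, hγΓ, hγ0, hγ1⟩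
  have hIcc : Icc a b ⊆ Icc (0 : ℝ) 1 := Icc_subset_Icc ha hb
  have h0K : γ 0 ∉ K := fun h => hdisj.le_bot ⟨⟨m, hm, hγ0.symm⟩, h⟩
  have h1K : γ 1 ∈ K := ((hcover (hγΓ (right_mem_Icc.2 zero_le_one))).resolve_left (hγ1 ▸ hy))
  have hA : IsCompact (Icc 0 1 ∩ γ ⁻¹' K) :=
    isCompact_Icc.of_isClosed_subset (hγ.preimage_isClosed_of_isClosed isClosed_Icc hK)
      inter_subset_left
  -- Up to the first time `T` in `K` the path stays on the arc over `[a, b]` and lifts to parameters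
  -- `σ`. At `T` the parameter has left `(a, b)`, so it has travelled at least to the nearer end.
  obtain ⟨T, ⟨hT, hTK⟩, hmin⟩ := hA.exists_isLeast ⟨1, right_mem_Icc.2 zero_le_one, h1K⟩
  have hT0 : 0 < T := hT.1.lt_of_ne fun h => h0K (h ▸ hTK)
  have hbefore : ∀ s ∈ Ico 0 T, γ s ∈ M.F e '' Ioo a b := by
    rintro s ⟨hs0, hsT⟩
    have hs1 : s ∈ Icc (0 : ℝ) 1 := ⟨hs0, hsT.le.trans hT.2⟩
    refine (hcover (hγΓ hs1)).resolve_right fun hsK => hsT.not_ge (hmin ⟨hs1, hsK⟩)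
  have hFcl : IsClosed (M.F e '' Icc a b) :=
    (isCompact_Icc.image_of_continuousOn ((F_continuousOn he).mono hIcc)).isClosed
  have hTmem : γ T ∈ M.F e '' Icc a b := by
    have hTcl : T ∈ closure (Ico 0 T) := by
      rw [closure_Ico hT0.ne]
      exact right_mem_Icc.2 hT0.le
    have hcw : ContinuousWithinAt γ (Ico 0 T) T :=
      (hγ T hT).mono fun s hs => ⟨hs.1, hs.2.le.trans hT.2⟩
    have := hcw.mem_closure hTcl (t := M.F e '' Icc a b)
      fun s hs => image_mono Ioo_subset_Icc_self (hbefore s hs)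
    rwa [hFcl.closure_eq] at this
  have hmem : ∀ s ∈ Icc 0 T, ∃ τ ∈ Icc a b, M.F e τ = γ s := by
    rintro s ⟨hs0, hsT⟩
    rcases hsT.eq_or_lt with rfl | hlt
    · exact hTmem
    · exact image_mono Ioo_subset_Icc_self (hbefore s ⟨hs0, hlt⟩)
  choose! σ hσ hFσ using hmem
  have hvar := ofReal_le_eVariationOn_of_lift (F := M.F e) (γ := γ) (σ := σ) (c := c / 2) hη
    (by positivity) hT0.le
    (fun t ht t' ht' h => hloc t ht t' ht' (hunif t ht t' ht' h))
    (hγ.mono (Icc_subset_Icc_right hT.2)) (fun s hs => hIcc (hσ s hs)) hFσ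
  have hσ0 : σ 0 = m := by
    have h := hFσ 0 (left_mem_Icc.2 hT0.le)
    rw [hγ0] at h
    exact F_injOn he (hIcc (hσ 0 (left_mem_Icc.2 hT0.le))) (hIcc (Ioo_subset_Icc_self hm)) h
  have hTr := right_mem_Icc.2 hT0.le
  have hσT : σ T ∉ Ioo a b := fun h => hdisj.le_bot ⟨⟨σ T, h, hFσ T hTr⟩, hTK⟩
  refine (ENNReal.ofReal_le_ofReal ?_).trans
    (hvar.trans (eVariationOn.mono _ (Icc_subset_Icc_right hT.2)))
  rw [hσ0]
  gcongr
  obtain ⟨h1, h2⟩ := hσ T hTr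
  rcases h1.eq_or_lt with h | h
  · rw [← h, abs_sub_comm]
    exact (min_le_left _ _).trans (le_abs_self _)
  · have : b ≤ σ T := not_lt.1 fun h' => hσT ⟨h, h'⟩
    exact (min_le_right _ _).trans ((sub_le_sub_right this m).trans (le_abs_self _))

theorem dist_F_le_hE {e : Finset Plane} (he : e ∈ M.bd) {s t : ℝ} (hs : s ∈ Icc (0 : ℝ) 1)
    (ht : t ∈ Icc (0 : ℝ) 1) : dist (M.F e s) (M.F e t) ≤ M.hE e :=
  Metric.dist_le_diam_of_mem (isCompact_Icc.image_of_continuousOn (F_continuousOn he)).isBounded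
    (mem_image_of_mem _ hs) (mem_image_of_mem _ ht)

theorem hE_pos {e : Finset Plane} (he : e ∈ M.bd) : 0 < M.hE e :=
  (dist_pos.2 (M.bd_ne e he)).trans_le (dist_F_le_hE he (by simp) (by simp))

/-- The chord is an edge of a shape regular triangle and cannot exceed the diameter of the arc; no
smallness of `h` is involved. -/
theorem h_le_mul_hE {κ : ℝ} (hκ : 1 ≤ κ) (hM : M.IsRegular κ) {e : Finset Plane} (he : e ∈ M.bd) :
    M.h ≤ 2 * κ ^ 2 * M.hE e := by
  obtain ⟨t, ht, het⟩ := M.bd_sub e he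
  have h1 := h_le_mul_hK hM ht
  have h2 := hK_le_mul_dist hκ hM ht (het (M.F_zero_mem he)) (het (M.F_one_mem he)) (M.bd_ne e he)
  have h3 : dist (M.F e 0) (M.F e 1) ≤ M.hE e := dist_F_le_hE he (by simp) (by simp)
  calc M.h ≤ κ * hK t := h1
    _ ≤ κ * (2 * κ * M.hE e) := by gcongr; exact h2.trans (by gcongr)
    _ = _ := by ring

/-- The diameter is at most the length, which by the shorter-arc condition is the arc distance of
the end points, hence at most a multiple of the chord once the chord is below `r`. -/
theorem hE_le_mul_h {r C : ℝ} (hC : 0 ≤ C)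
    (harc : ∀ x ∈ frontier Ω, ∀ y ∈ frontier Ω, dist x y < r →
      arcDist (frontier Ω) x y ≤ ENNReal.ofReal (C * dist x y))
    (hh : M.h < r) {e : Finset Plane} (he : e ∈ M.bd) : M.hE e ≤ C * M.h := by
  obtain ⟨t, ht, het⟩ := M.bd_sub e he
  have h0 : (0 : ℝ) ∈ Icc (0 : ℝ) 1 := by simp
  have h1 : (1 : ℝ) ∈ Icc (0 : ℝ) 1 := by simp
  have hd : dist (M.F e 0) (M.F e 1) ≤ M.h :=
    (Metric.dist_le_diam_of_mem (isCompact_tri t).isBounded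
      (subset_convexHull ℝ _ (het (M.F_zero_mem he)))
      (subset_convexHull ℝ _ (het (M.F_one_mem he)))).trans (hK_le_h ht)
  have hv := (M.bd_short e he).trans
    (harc _ (M.F_mem he h0) _ (M.F_mem he h1) (hd.trans_lt hh))
  have hh0 : 0 ≤ M.h := dist_nonneg.trans hd
  refine Metric.diam_le_of_forall_dist_le (by positivity) ?_
  rintro _ ⟨s, hs, rfl⟩ _ ⟨s', hs', rfl⟩
  have h2 := (eVariationOn.edist_le (M.F e) hs hs').trans hv
  rw [edist_dist, ENNReal.ofReal_le_ofReal_iff (by positivity)] at h2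
  exact h2.trans (by gcongr)

theorem arcDist_F_le {κ : ℝ} (hM : M.IsRegular κ) {e : Finset Plane} (he : e ∈ M.bd) {a b : ℝ}
    (ha : 0 ≤ a) (hab : a ≤ b) (hb : b ≤ 1) :
    arcDist (frontier Ω) (M.F e a) (M.F e b) ≤ ENNReal.ofReal (κ * M.hE e * (b - a)) := by
  have h0 : 0 ≤ κ * M.hE e := (norm_nonneg _).trans (hM.dF_le e he 0 (by simp))
  refine arcDist_le_of_dist_le h0 hab
    (fun s hs => M.F_mem he ⟨ha.trans hs.1, hs.2.trans hb⟩) fun s hs t ht => ?_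
  have := (convex_Icc (0 : ℝ) 1).norm_image_sub_le_of_norm_derivWithin_le
    ((M.F_smooth e he).differentiableOn (by simp)) (hM.dF_le e he)
    ⟨ha.trans hs.1, hs.2.trans hb⟩ ⟨ha.trans ht.1, ht.2.trans hb⟩
  rwa [Real.norm_eq_abs, ← dist_eq_norm, dist_comm, abs_sub_comm] at this

end CurvedMesh

/-! ### Measurement points and coercivity of the empirical inner product -/

theorem UniformlyDistributed.mono {Γ : Set Plane} {n : ℕ} {x : Fin n → Γ} {B B' : ℝ} (h : B ≤ B')
    (hx : UniformlyDistributed x B) : UniformlyDistributed x B' where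
  injective := hx.injective
  ratio := hx.ratio.trans (by gcongr)

namespace CurvedMesh

variable {Ω : Set Plane} {M : CurvedMesh Ω} {n : ℕ} {x : Fin n → frontier Ω}

theorem mem_pts {e : Finset Plane} {i : Fin n} : i ∈ M.pts x e ↔ (x i : Plane) ∈ M.elem e := by
  simp [pts]

theorem F_invFunOn {e : Finset Plane} {i : Fin n} (hi : i ∈ M.pts x e) :
    Function.invFunOn (M.F e) (Icc 0 1) (x i) ∈ Icc (0 : ℝ) 1 ∧
      M.F e (Function.invFunOn (M.F e) (Icc 0 1) (x i)) = x i := by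
  have h : (x i : Plane) ∈ M.F e '' Icc 0 1 := mem_pts.1 hi
  exact ⟨Function.invFunOn_mem h, Function.invFunOn_eq h⟩

theorem params_subset (e : Finset Plane) : (M.params x e : Set ℝ) ⊆ Icc 0 1 := by
  intro s hs
  obtain ⟨i, hi, rfl⟩ := Finset.mem_image.1 hs
  exact (F_invFunOn hi).1

theorem exists_F_eq_of_mem_params {e : Finset Plane} {s : ℝ} (hs : s ∈ M.params x e) :
    ∃ i, M.F e s = x i := by
  obtain ⟨i, hi, rfl⟩ := Finset.mem_image.1 hs
  exact ⟨i, (F_invFunOn hi).2⟩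

theorem mem_params_of_F_eq {e : Finset Plane} (he : e ∈ M.bd) {s : ℝ} (hs : s ∈ Icc (0 : ℝ) 1)
    {i : Fin n} (h : M.F e s = x i) : s ∈ M.params x e := by
  have hi : i ∈ M.pts x e := mem_pts.2 ⟨s, hs, h⟩
  obtain ⟨h1, h2⟩ := F_invFunOn hi
  exact Finset.mem_image.2 ⟨i, hi, F_injOn he h1 hs (h2.trans h.symm)⟩

theorem card_params (hx : Function.Injective x) (e : Finset Plane) :
    (M.params x e).card = (M.pts x e).card := by
  refine Finset.card_image_of_injOn fun i hi j hj h => hx (Subtype.ext ?_)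
  rw [← (F_invFunOn hi).2, ← (F_invFunOn hj).2]
  exact congrArg _ h

/-- Parts of boundary elements that contain no measurement point are not much longer than the
distance of the first two measurement points of an element. -/
theorem sub_le_mul_quadGap_two {κ B : ℝ} (hκ : 1 ≤ κ) (hM : M.IsRegular κ)
    (hB : 1 ≤ B) (hx : UniformlyDistributed x B) {e : Finset Plane} (he : e ∈ M.bd)
    (h2 : 2 ≤ (M.pts x e).card) {a b : ℝ} (ha : 0 ≤ a) (hb : b ≤ 1)
    (hfree : ∀ s ∈ M.params x e, s ∉ Ioo a b) :
    b - a ≤ 4 * B * κ ^ 2 * quadGap (M.params x e) 2 := by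
  have hS := params_subset (M := M) (x := x) e
  have hgap := quadGap_nonneg hS 2
  have hcard : 2 ≤ (M.params x e).card := by rwa [card_params hx.injective]
  rcases le_or_gt b a with hab | hab
  · have : 0 ≤ 4 * B * κ ^ 2 * quadGap (M.params x e) 2 := by positivity
    linarith
  have hIoo : Ioo a b ⊆ Icc (0 : ℝ) 1 := fun s hs => ⟨ha.trans hs.1.le, hs.2.le.trans hb⟩
  have hE := hE_pos he
  set m := (a + b) / 2 with hm
  have hmI : m ∈ Ioo a b := ⟨by linarith, by linarith⟩
  have hc : 0 < M.hE e / κ := by positivity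
  -- The midpoint of the free arc is far from every measurement point, a lower bound for `s_max`.
  have hlow : ∀ i, ENNReal.ofReal (M.hE e / κ / 2 * ((b - a) / 2)) ≤
      arcDist (frontier Ω) (M.F e m) (x i) := by
    intro i
    have := le_arcDist_of_not_mem_image_Ioo he hc (fun s hs => by
      rw [div_le_iff₀ (by positivity), mul_comm]; exact hM.le_dF e he s hs) ha hb hmI
      (y := x i) (by
        rintro ⟨s, hs, h⟩
        exact hfree s (mem_params_of_F_eq he (hIoo hs) h) hs)
    rwa [show m - a = (b - a) / 2 by rw [hm]; ring, show b - m = (b - a) / 2 by rw [hm]; ring,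
      min_self] at this
  have h1mem : quadNode (M.params x e) 1 ∈ M.params x e :=
    quadNode_mem (Finset.mem_Icc.2 ⟨le_rfl, by omega⟩)
  have h2mem : quadNode (M.params x e) 2 ∈ M.params x e :=
    quadNode_mem (Finset.mem_Icc.2 ⟨by omega, hcard⟩)
  have hlt : quadNode (M.params x e) 1 < quadNode (M.params x e) 2 :=
    quadNode_lt le_rfl (by omega) hcard
  obtain ⟨i, hi⟩ := exists_F_eq_of_mem_params h1mem
  obtain ⟨j, hj⟩ := exists_F_eq_of_mem_params h2mem
  have hij : i ≠ j := by
    rintro rfl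
    exact hlt.ne (F_injOn he (hS h1mem) (hS h2mem) (hi.trans hj.symm))
  -- The first two points on the element bound `s_min` from above.
  have hmin : (⨅ (i) (j) (_ : i ≠ j), arcDist (frontier Ω) (x i) (x j)) ≤
      ENNReal.ofReal (κ * M.hE e * quadGap (M.params x e) 2) := by
    refine (iInf_le_of_le i (iInf₂_le j hij)).trans ?_
    rw [← hi, ← hj]
    exact arcDist_F_le hM he (hS h1mem).1 hlt.le (hS h2mem).2
  have hfin : ENNReal.ofReal (M.hE e / κ / 2 * ((b - a) / 2)) ≤
      ENNReal.ofReal (B * (κ * M.hE e * quadGap (M.params x e) 2)) := by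
    rw [ENNReal.ofReal_mul (by positivity : (0 : ℝ) ≤ B)]
    refine (le_iInf hlow).trans (le_trans ?_ (hx.ratio.trans (by gcongr)))
    exact le_iSup (fun y : frontier Ω => ⨅ i, arcDist (frontier Ω) y (x i))
      ⟨M.F e m, M.F_mem he (hIoo hmI)⟩
  rw [ENNReal.ofReal_le_ofReal_iff (by positivity)] at hfin
  have h3 : M.hE e * (b - a) ≤ M.hE e * (4 * B * κ ^ 2 * quadGap (M.params x e) 2) := by
    have h4 := mul_le_mul_of_nonneg_left hfin (by positivity : 0 ≤ 4 * κ)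
    have h5 : 4 * κ * (M.hE e / κ / 2 * ((b - a) / 2)) = M.hE e * (b - a) := by
      field_simp
      ring
    rw [h5] at h4
    linarith
  exact le_of_mul_le_mul_left h3 hE

/-- The sum of the squares of the nodal values, over all boundary elements. -/
noncomputable def nodalSq (μ : M.Qh) : ℝ :=
  ∑ e ∈ M.bd, (zeroExt (μ : C(frontier Ω, ℝ)) (M.F e 0) ^ 2 +
    zeroExt (μ : C(frontier Ω, ℝ)) (M.F e 1) ^ 2)

theorem zeroExt_F (μ : M.Qh) {e : Finset Plane} (he : e ∈ M.bd) {s : ℝ} (hs : s ∈ Icc (0 : ℝ) 1) :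
    zeroExt (μ : C(frontier Ω, ℝ)) (M.F e s) = zeroExt (μ : C(frontier Ω, ℝ)) (M.F e 0) +
      (zeroExt (μ : C(frontier Ω, ℝ)) (M.F e 1) - zeroExt (μ : C(frontier Ω, ℝ)) (M.F e 0)) * s := by
  obtain ⟨p, q, h⟩ := μ.2 e he
  rw [h s hs, h 0 (by simp), h 1 (by simp)]
  ring

/-- Every quadrature node is a measurement point whose weight contains the term in question; all
other terms are nonnegative. A point shared by two elements contributes to both. -/
theorem elem_sum_le_emp (hx : Function.Injective x) (h2 : ∀ e ∈ M.bd, 2 ≤ (M.pts x e).card)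
    (μ : M.Qh) : ∑ e ∈ M.bd, ∑ k ∈ Finset.Icc 1 (M.params x e).card,
      quadWeight (M.params x e) k * ‖M.dF e (quadNode (M.params x e) k)‖ *
        zeroExt (μ : C(frontier Ω, ℝ)) (M.F e (quadNode (M.params x e) k)) ^ 2 ≤
    M.emp x (atPts x μ) (atPts x μ) := by
  classical
  simp only [emp, weight, Finset.sum_mul]
  rw [Finset.sum_comm]
  refine Finset.sum_le_sum fun e he => ?_
  rw [Finset.sum_comm]
  refine Finset.sum_le_sum fun k hk => ?_
  have hw : 0 ≤ quadWeight (M.params x e) k :=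
    quadWeight_nonneg (params_subset e) (by rw [card_params hx]; exact h2 e he) k
  obtain ⟨i, hi⟩ := exists_F_eq_of_mem_params (quadNode_mem hk)
  have hsingle := Finset.single_le_sum (f := fun i => (if M.F e (quadNode (M.params x e) k) = x i
    then quadWeight (M.params x e) k * ‖M.dF e (quadNode (M.params x e) k)‖ else 0) *
      atPts x μ i * atPts x μ i) (s := Finset.univ) (fun j _ => by
      rw [mul_assoc]
      refine mul_nonneg ?_ (mul_self_nonneg _)
      split_ifs <;> positivity) (Finset.mem_univ i)
  refine le_trans (le_of_eq ?_) hsingle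
  simp only [if_pos hi, atPts]
  rw [hi, zeroExt_apply _ (x i).2]
  ring

/-- The empirical inner product is bounded from below on `Q_h`. -/
theorem h_mul_nodalSq_le {κ B : ℝ} (hκ : 1 ≤ κ) (hM : M.IsRegular κ) (hB : 1 ≤ B)
    (hx : UniformlyDistributed x B) (h2 : ∀ e ∈ M.bd, 2 ≤ (M.pts x e).card) (μ : M.Qh) :
    M.h * nodalSq μ ≤ 2592 * κ ^ 3 * (4 * B * κ ^ 2) ^ 3 * M.emp x (atPts x μ) (atPts x μ) := by
  set D := 4 * B * κ ^ 2 with hD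
  have hκ2 : 1 ≤ κ ^ 2 := one_le_pow₀ hκ
  have hD1 : 1 ≤ D := by nlinarith
  refine le_trans ?_ (mul_le_mul_of_nonneg_left (elem_sum_le_emp hx.injective h2 μ) (by positivity))
  rw [nodalSq, Finset.mul_sum, Finset.mul_sum]
  refine Finset.sum_le_sum fun e he => ?_
  set S := M.params x e with hS
  have hS01 : (S : Set ℝ) ⊆ Icc 0 1 := params_subset e
  have hcard : 2 ≤ S.card := by rw [hS, card_params hx.injective]; exact h2 e he
  have hnode : ∀ k ∈ Finset.Icc 1 S.card, quadNode S k ∈ Icc (0 : ℝ) 1 :=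
    fun k hk => hS01 (quadNode_mem hk)
  have hfirst : quadGap S 1 ≤ D * quadGap S 2 := by
    have := sub_le_mul_quadGap_two hκ hM hB hx he (h2 e he) (a := 0) (b := quadNode S 1) le_rfl
      (hnode 1 (Finset.mem_Icc.2 ⟨le_rfl, by omega⟩)).2
      fun s hs hI => hI.2.not_ge (quadNode_one_le hs)
    rwa [← quadNode_zero S] at this
  have hlast : quadGap S (S.card + 1) ≤ D * quadGap S 2 := by
    have := sub_le_mul_quadGap_two hκ hM hB hx he (h2 e he) (a := quadNode S S.card) (b := 1)
      (hnode S.card (Finset.mem_Icc.2 ⟨by omega, le_rfl⟩)).1 le_rfl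
      fun s hs hI => hI.1.not_ge (le_quadNode_card hs)
    rwa [← quadNode_card_succ S] at this
  have hq := sq_add_sq_le_quad hS01 hcard hD1 hfirst hlast
    (zeroExt (μ : C(frontier Ω, ℝ)) (M.F e 0))
    (zeroExt (μ : C(frontier Ω, ℝ)) (M.F e 1) - zeroExt (μ : C(frontier Ω, ℝ)) (M.F e 0))
  rw [add_sub_cancel] at hq
  have hsum : M.hE e * ∑ k ∈ Finset.Icc 1 S.card, quadWeight S k *
      (zeroExt (μ : C(frontier Ω, ℝ)) (M.F e 0) + (zeroExt (μ : C(frontier Ω, ℝ)) (M.F e 1) -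
        zeroExt (μ : C(frontier Ω, ℝ)) (M.F e 0)) * quadNode S k) ^ 2 ≤
      κ * ∑ k ∈ Finset.Icc 1 S.card, quadWeight S k * ‖M.dF e (quadNode S k)‖ *
        zeroExt (μ : C(frontier Ω, ℝ)) (M.F e (quadNode S k)) ^ 2 := by
    rw [Finset.mul_sum, Finset.mul_sum]
    refine Finset.sum_le_sum fun k hk => ?_
    rw [← zeroExt_F μ he (hnode k hk)]
    have h1 := hM.le_dF e he _ (hnode k hk)
    have h3 : 0 ≤ quadWeight S k * zeroExt (μ : C(frontier Ω, ℝ)) (M.F e (quadNode S k)) ^ 2 :=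
      mul_nonneg (quadWeight_nonneg hS01 hcard k) (sq_nonneg _)
    have := mul_le_mul_of_nonneg_right h1 h3
    linarith
  -- The constant collects `h ≤ 2 κ² h_E`, the quadrature factor `1296 D³`, and one `κ` from the
  -- speed bound.
  have hhE := h_le_mul_hE hκ hM he
  have hE := hE_pos he
  set N := zeroExt (μ : C(frontier Ω, ℝ)) (M.F e 0) ^ 2 +
    zeroExt (μ : C(frontier Ω, ℝ)) (M.F e 1) ^ 2 with hN
  have hN0 : 0 ≤ N := by positivity
  have e1 := mul_le_mul_of_nonneg_right hhE hN0
  have e2 := mul_le_mul_of_nonneg_left hq (by positivity : 0 ≤ 2 * κ ^ 2 * M.hE e)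
  have e3 := mul_le_mul_of_nonneg_left hsum (by positivity : 0 ≤ 2592 * κ ^ 2 * D ^ 3)
  linarith

end CurvedMesh

/-! ### Transfer, extension and the mesh-dependent norms -/

theorem IsPreconnected.subsingleton_of_finite {s : Set ℝ} (hs : IsPreconnected s)
    (hf : s.Finite) : s.Subsingleton := by
  have key : ∀ a ∈ s, ∀ b ∈ s, ¬ a < b := fun a ha b hb hab =>
    Icc_infinite hab (hf.subset (hs.ordConnected.out ha hb))
  exact fun a ha b hb => le_antisymm (not_lt.1 (key b hb a ha)) (not_lt.1 (key a ha b hb))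

namespace CurvedMesh

variable {Ω : Set Plane} {M : CurvedMesh Ω}

theorem zeroExt_Pi (v : M.Vh) {e : Finset Plane} (he : e ∈ M.bd) {y : Plane} (hy : y ∈ e) :
    zeroExt (M.Pi v : C(frontier Ω, ℝ)) y = zeroExt (v : C(M.Ωh, ℝ)) y :=
  (M.existsUnique_Pi v).exists.choose_spec e he y hy

theorem Pi_unique {v : M.Vh} {w : M.Qh} (h : ∀ e ∈ M.bd, ∀ y ∈ e,
    zeroExt (w : C(frontier Ω, ℝ)) y = zeroExt (v : C(M.Ωh, ℝ)) y) : M.Pi v = w :=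
  (M.existsUnique_Pi v).unique (fun _ he _ hy => zeroExt_Pi v he hy) h

variable (M) in
/-- The transfer operator `Π_h` as a linear map. -/
noncomputable def PiLinear : M.Vh →ₗ[ℝ] M.Qh where
  toFun := M.Pi
  map_add' u v := Pi_unique fun e he y hy => by
    simp only [Submodule.coe_add, zeroExt_add, zeroExt_Pi _ he hy]
  map_smul' c v := Pi_unique fun e he y hy => by
    simp only [Submodule.coe_smul, zeroExt_smul, zeroExt_Pi _ he hy, RingHom.id_apply]

theorem PiLinear_apply (v : M.Vh) : M.PiLinear v = M.Pi v := rfl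

open Classical in
/-- The extension of a boundary function by zero at the interior nodes. -/
noncomputable def extend (μ : M.Qh) : M.Vh :=
  M.interp fun y => if ∃ e ∈ M.bd, y ∈ e then zeroExt (μ : C(frontier Ω, ℝ)) y else 0

theorem Pi_extend (μ : M.Qh) : M.Pi (extend μ) = μ :=
  Pi_unique fun e he y hy => by
    obtain ⟨t, ht, het⟩ := M.bd_sub e he
    rw [extend, M.interp_apply _ ht (het hy), if_pos ⟨e, he, hy⟩]

theorem sum_sq_bd (μ : M.Qh) {e : Finset Plane} (he : e ∈ M.bd) :
    ∑ y ∈ e, zeroExt (μ : C(frontier Ω, ℝ)) y ^ 2 =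
      zeroExt (μ : C(frontier Ω, ℝ)) (M.F e 0) ^ 2 +
        zeroExt (μ : C(frontier Ω, ℝ)) (M.F e 1) ^ 2 := by
  classical
  conv_lhs => rw [bd_eq_pair he]
  rw [Finset.sum_pair (M.bd_ne e he)]

theorem nodalSq_nonneg (μ : M.Qh) : 0 ≤ nodalSq μ :=
  Finset.sum_nonneg fun _ _ => by positivity

/-- Only boundary nodes contribute. Each lies on some boundary edge, so its square is dominated by
the sum over edges, and it is counted once for each triangle at that node, at most `16 κ⁴` times. -/
theorem sum_sq_extend_le {κ : ℝ} (hκ : 1 ≤ κ) (hM : M.IsRegular κ) (μ : M.Qh) :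
    ∑ t ∈ M.tri, ∑ y ∈ t, zeroExt (extend μ : C(M.Ωh, ℝ)) y ^ 2 ≤ 16 * κ ^ 4 * nodalSq μ := by
  classical
  calc ∑ t ∈ M.tri, ∑ y ∈ t, zeroExt (extend μ : C(M.Ωh, ℝ)) y ^ 2
      ≤ ∑ t ∈ M.tri, ∑ y ∈ t, ∑ e ∈ M.bd, ∑ z ∈ e,
          if y = z then zeroExt (μ : C(frontier Ω, ℝ)) z ^ 2 else 0 := by
        refine Finset.sum_le_sum fun t ht => Finset.sum_le_sum fun y hy => ?_
        have hnn : ∀ e ∈ M.bd, 0 ≤ ∑ z ∈ e,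
            if y = z then zeroExt (μ : C(frontier Ω, ℝ)) z ^ 2 else 0 := fun e _ =>
          Finset.sum_nonneg fun z _ => by split_ifs <;> positivity
        rw [extend, M.interp_apply _ ht hy]
        split_ifs with h
        · obtain ⟨e, he, hye⟩ := h
          refine le_trans (le_of_eq ?_) (Finset.single_le_sum hnn he)
          rw [Finset.sum_ite_eq, if_pos hye]
        · rw [zero_pow two_ne_zero]
          exact Finset.sum_nonneg hnn
    _ = ∑ e ∈ M.bd, ∑ z ∈ e, ((M.tri.filter fun t => z ∈ t).card : ℝ) *
          zeroExt (μ : C(frontier Ω, ℝ)) z ^ 2 := by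
        have h1 : ∀ t ∈ M.tri, (∑ y ∈ t, ∑ e ∈ M.bd, ∑ z ∈ e,
            if y = z then zeroExt (μ : C(frontier Ω, ℝ)) z ^ 2 else 0) =
            ∑ e ∈ M.bd, ∑ z ∈ e, if z ∈ t then zeroExt (μ : C(frontier Ω, ℝ)) z ^ 2 else 0 := by
          intro t _
          rw [Finset.sum_comm]
          refine Finset.sum_congr rfl fun e _ => ?_
          rw [Finset.sum_comm]
          refine Finset.sum_congr rfl fun z _ => ?_
          rw [Finset.sum_ite_eq']
        rw [Finset.sum_congr rfl h1, Finset.sum_comm]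
        refine Finset.sum_congr rfl fun e _ => ?_
        rw [Finset.sum_comm]
        refine Finset.sum_congr rfl fun z _ => ?_
        rw [← Finset.sum_filter, Finset.sum_const, nsmul_eq_mul]
    _ ≤ ∑ e ∈ M.bd, ∑ z ∈ e, 16 * κ ^ 4 * zeroExt (μ : C(frontier Ω, ℝ)) z ^ 2 := by
        refine Finset.sum_le_sum fun e _ => Finset.sum_le_sum fun z _ => ?_
        gcongr
        exact card_triangles_at_le hκ hM z
    _ = _ := by
        rw [nodalSq, Finset.mul_sum]
        refine Finset.sum_congr rfl fun e he => ?_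
        rw [← Finset.mul_sum, sum_sq_bd μ he]

theorem gradInner_extend_le {κ : ℝ} (hκ : 1 ≤ κ) (hM : M.IsRegular κ) (μ : M.Qh) :
    M.gradInner (extend μ) (extend μ) ≤ 256 * Real.pi * κ ^ 6 * nodalSq μ := by
  have hpi := Real.pi_pos
  calc M.gradInner (extend μ) (extend μ) ≤ _ := gradInner_self_le hκ hM _
    _ ≤ 16 * Real.pi * κ ^ 2 * (16 * κ ^ 4 * nodalSq μ) := by
        gcongr
        exact sum_sq_extend_le hκ hM μ
    _ = _ := by ring

theorem integral_affine_sq (p q : ℝ) :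
    ∫ s in (0 : ℝ)..1, (p + (q - p) * s) ^ 2 = (p ^ 2 + p * q + q ^ 2) / 3 := by
  have h : ∀ s ∈ uIcc (0 : ℝ) 1, HasDerivAt
      (fun s => p ^ 2 * s + p * (q - p) * s ^ 2 + (q - p) ^ 2 * s ^ 3 / 3)
      ((p + (q - p) * s) ^ 2) s := by
    intro s _
    have h1 := ((hasDerivAt_id s).const_mul (p ^ 2)).add
      ((hasDerivAt_pow 2 s).const_mul (p * (q - p)))
    have h2 := h1.add (((hasDerivAt_pow 3 s).const_mul ((q - p) ^ 2)).div_const 3)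
    refine (h2.congr_deriv ?_)
    simp
    ring
  rw [intervalIntegral.integral_eq_sub_of_hasDerivAt h
    (Continuous.intervalIntegrable (by fun_prop) _ _)]
  ring

/-- The speed lies between `h_E / κ` and `κ h_E`, and `(p² + pq + q²) / 3` is comparable with `p² +
q²`. -/
theorem l2SqE_bounds {κ : ℝ} (hκ : 1 ≤ κ) (hM : M.IsRegular κ) (μ : M.Qh) {e : Finset Plane}
    (he : e ∈ M.bd) :
    M.hE e * (zeroExt (μ : C(frontier Ω, ℝ)) (M.F e 0) ^ 2 +
        zeroExt (μ : C(frontier Ω, ℝ)) (M.F e 1) ^ 2) ≤ 6 * κ * M.l2SqE μ e ∧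
      M.l2SqE μ e ≤ κ * (M.hE e * (zeroExt (μ : C(frontier Ω, ℝ)) (M.F e 0) ^ 2 +
        zeroExt (μ : C(frontier Ω, ℝ)) (M.F e 1) ^ 2)) := by
  set p := zeroExt (μ : C(frontier Ω, ℝ)) (M.F e 0) with hp
  set q := zeroExt (μ : C(frontier Ω, ℝ)) (M.F e 1) with hq
  have hE := hE_pos he
  have heq : M.l2SqE μ e = ∫ s in (0 : ℝ)..1, (p + (q - p) * s) ^ 2 * ‖M.dF e s‖ := by
    refine intervalIntegral.integral_congr fun s hs => ?_
    rw [uIcc_of_le zero_le_one] at hs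
    simp only [zeroExt_F μ he hs, ← hp, ← hq]
  have hd : ContinuousOn (M.dF e) (Icc 0 1) :=
    (M.F_smooth e he).continuousOn_derivWithin (uniqueDiffOn_Icc zero_lt_one) (by simp)
  have hint : IntervalIntegrable (fun s => (p + (q - p) * s) ^ 2 * ‖M.dF e s‖) volume 0 1 := by
    refine ContinuousOn.intervalIntegrable ?_
    rw [uIcc_of_le zero_le_one]
    exact ContinuousOn.mul (by fun_prop) hd.norm
  have hint2 : ∀ c : ℝ, IntervalIntegrable (fun s => (p + (q - p) * s) ^ 2 * c) volume 0 1 :=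
    fun c => Continuous.intervalIntegrable (by fun_prop) _ _
  have hlow : (p ^ 2 + p * q + q ^ 2) / 3 * (M.hE e / κ) ≤ M.l2SqE μ e := by
    rw [heq, ← integral_affine_sq, ← intervalIntegral.integral_mul_const]
    refine intervalIntegral.integral_mono_on zero_le_one (hint2 _) hint fun s hs => ?_
    refine mul_le_mul_of_nonneg_left ?_ (sq_nonneg _)
    rw [div_le_iff₀ (by positivity), mul_comm]
    exact hM.le_dF e he s hs
  have hup : M.l2SqE μ e ≤ (p ^ 2 + p * q + q ^ 2) / 3 * (κ * M.hE e) := by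
    rw [heq, ← integral_affine_sq, ← intervalIntegral.integral_mul_const]
    refine intervalIntegral.integral_mono_on zero_le_one hint (hint2 _) fun s hs => ?_
    exact mul_le_mul_of_nonneg_left (hM.dF_le e he s hs) (sq_nonneg _)
  constructor
  · have h1 := mul_le_mul_of_nonneg_left hlow (by positivity : 0 ≤ 6 * κ)
    have h2 : 6 * κ * ((p ^ 2 + p * q + q ^ 2) / 3 * (M.hE e / κ)) =
        M.hE e * (p ^ 2 + q ^ 2 + (p + q) ^ 2) := by
      field_simp
      ring
    rw [h2] at h1
    refine le_trans (mul_le_mul_of_nonneg_left ?_ hE.le) h1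
    linarith [sq_nonneg (p + q)]
  · refine hup.trans ?_
    have h1 : (p ^ 2 + p * q + q ^ 2) / 3 ≤ p ^ 2 + q ^ 2 := by nlinarith [sq_nonneg (p - q)]
    calc _ ≤ (p ^ 2 + q ^ 2) * (κ * M.hE e) := by gcongr
      _ = _ := by ring

theorem l2SqE_nonneg (μ : M.Qh) (e : Finset Plane) : 0 ≤ M.l2SqE μ e :=
  intervalIntegral.integral_nonneg zero_le_one fun _ _ => by positivity

theorem normQ_sq (μ : M.Qh) : M.normQ μ ^ 2 = ∑ e ∈ M.bd, M.hE e * M.l2SqE μ e :=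
  Real.sq_sqrt (Finset.sum_nonneg fun e he => mul_nonneg (hE_pos he).le (l2SqE_nonneg μ e))

variable (M) in
/-- The boundary part of the norm of `V_h`. -/
noncomputable def bdSq (v : M.Vh) : ℝ := ∑ e ∈ M.bd, (M.hE e)⁻¹ * M.l2SqE (M.Pi v) e

theorem bdSq_nonneg (v : M.Vh) : 0 ≤ M.bdSq v :=
  Finset.sum_nonneg fun e he => mul_nonneg (inv_nonneg.2 (hE_pos he).le) (l2SqE_nonneg _ e)

theorem normV_sq (v : M.Vh) : M.normV v ^ 2 = M.gradInner v v + M.bdSq v :=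
  Real.sq_sqrt (add_nonneg (M.gradInner_self_nonneg v) (bdSq_nonneg v))

theorem normQ_sq_le {κ C : ℝ} (hκ : 1 ≤ κ) (hM : M.IsRegular κ)
    (hC : ∀ e ∈ M.bd, M.hE e ≤ C * M.h) (μ : M.Qh) :
    M.normQ μ ^ 2 ≤ κ * C ^ 2 * (M.h ^ 2 * nodalSq μ) := by
  rw [normQ_sq, nodalSq, Finset.mul_sum, Finset.mul_sum]
  refine Finset.sum_le_sum fun e he => ?_
  have hE := hE_pos he
  have h1 := mul_le_mul_of_nonneg_left (l2SqE_bounds hκ hM μ he).2 hE.le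
  have h2 : M.hE e ^ 2 ≤ (C * M.h) ^ 2 := pow_le_pow_left₀ hE.le (hC e he) 2
  set N := zeroExt (μ : C(frontier Ω, ℝ)) (M.F e 0) ^ 2 +
    zeroExt (μ : C(frontier Ω, ℝ)) (M.F e 1) ^ 2
  have hN : 0 ≤ κ * N := by positivity
  have h3 := mul_le_mul_of_nonneg_right h2 hN
  linarith

/-- This direction serves the definiteness of the norm and the finiteness of the dual norms; its
constant does not enter the final estimate. -/
theorem h_sq_mul_nodalSq_le {κ : ℝ} (hκ : 1 ≤ κ) (hM : M.IsRegular κ) (μ : M.Qh) :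
    M.h ^ 2 * nodalSq μ ≤ 24 * κ ^ 5 * M.normQ μ ^ 2 := by
  rw [normQ_sq, nodalSq, Finset.mul_sum, Finset.mul_sum]
  refine Finset.sum_le_sum fun e he => ?_
  have hE := hE_pos he
  have hh : 0 ≤ M.h := by
    obtain ⟨t, ht, -⟩ := M.bd_sub e he
    exact (diam_pos ht).le.trans (hK_le_h ht)
  have h1 := mul_le_mul_of_nonneg_left (l2SqE_bounds hκ hM μ he).1 hE.le
  have h2 : M.h ^ 2 ≤ (2 * κ ^ 2 * M.hE e) ^ 2 := pow_le_pow_left₀ hh (h_le_mul_hE hκ hM he) 2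
  set N := zeroExt (μ : C(frontier Ω, ℝ)) (M.F e 0) ^ 2 +
    zeroExt (μ : C(frontier Ω, ℝ)) (M.F e 1) ^ 2
  have hN : 0 ≤ N := by positivity
  have h3 := mul_le_mul_of_nonneg_right h2 hN
  have h4 := mul_le_mul_of_nonneg_left h1 (by positivity : 0 ≤ 4 * κ ^ 4)
  linarith

theorem bdSq_le {κ : ℝ} (hκ : 1 ≤ κ) (hM : M.IsRegular κ) (v : M.Vh) :
    M.bdSq v ≤ κ * nodalSq (M.Pi v) := by
  rw [bdSq, nodalSq, Finset.mul_sum]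
  refine Finset.sum_le_sum fun e he => ?_
  have hE := hE_pos he
  rw [inv_mul_le_iff₀ hE]
  exact ((l2SqE_bounds hκ hM (M.Pi v) he).2).trans (le_of_eq (by ring))

theorem nodalSq_le {κ : ℝ} (hκ : 1 ≤ κ) (hM : M.IsRegular κ) (v : M.Vh) :
    nodalSq (M.Pi v) ≤ 6 * κ * M.bdSq v := by
  rw [bdSq, nodalSq, Finset.mul_sum]
  refine Finset.sum_le_sum fun e he => ?_
  have hE := hE_pos he
  rw [mul_left_comm, le_inv_mul_iff₀ hE]
  exact (l2SqE_bounds hκ hM (M.Pi v) he).1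

theorem eq_zero_of_nodalSq {μ : M.Qh} (h : nodalSq μ = 0) : μ = 0 := by
  rw [nodalSq, Finset.sum_eq_zero_iff_of_nonneg fun _ _ => by positivity] at h
  apply Subtype.ext
  ext ⟨y, hy⟩
  have hy2 := hy
  rw [← M.bd_cover] at hy2
  obtain ⟨e, he, s, hs, rfl⟩ := mem_iUnion₂.1 hy2
  have h0 := h e he
  have hp : zeroExt (μ : C(frontier Ω, ℝ)) (M.F e 0) = 0 := by
    nlinarith [sq_nonneg (zeroExt (μ : C(frontier Ω, ℝ)) (M.F e 0)),
      sq_nonneg (zeroExt (μ : C(frontier Ω, ℝ)) (M.F e 1))]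
  have hq : zeroExt (μ : C(frontier Ω, ℝ)) (M.F e 1) = 0 := by
    nlinarith [sq_nonneg (zeroExt (μ : C(frontier Ω, ℝ)) (M.F e 0)),
      sq_nonneg (zeroExt (μ : C(frontier Ω, ℝ)) (M.F e 1))]
  change (μ : C(frontier Ω, ℝ)) ⟨M.F e s, hy⟩ = 0
  rw [← zeroExt_apply _ hy, zeroExt_F μ he hs, hp, hq]
  ring

theorem connectedSpace_Ωh (hΩ : IsConnected Ω) : ConnectedSpace M.Ωh := by
  have hbij : BijOn M.Φ M.Ωh (closure Ω) := by
    have h := M.Φ_inj.bijOn_image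
    rwa [M.Φ_image] at h
  let ψ : M.Ωh ≃ closure Ω := hbij.equiv
  have hψ : Continuous ψ :=
    (continuousOn_iff_continuous_domRestrict.1 M.Φ_cont).subtype_mk _
  have : CompactSpace M.Ωh := isCompact_iff_compactSpace.1 M.isCompact_Ωh
  let H : M.Ωh ≃ₜ closure Ω := hψ.homeoOfEquivCompactToT2
  have : ConnectedSpace (closure Ω) := isConnected_iff_connectedSpace.1 hΩ.closure
  exact H.symm.surjective.connectedSpace H.symm.continuous

theorem bd_nonempty (h : (frontier Ω).Nonempty) : M.bd.Nonempty := by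
  obtain ⟨y, hy⟩ := h
  rw [← M.bd_cover] at hy
  obtain ⟨e, he, -⟩ := mem_iUnion₂.1 hy
  exact ⟨e, he⟩

/-- A function with zero slopes takes finitely many values on a connected set, hence a single one,
and this is its value at a boundary node. -/
theorem eq_zero_of_slope_of_nodalSq (hΩ : IsSmoothBoundedDomain Ω) {v : M.Vh}
    (hs : ∀ t ∈ M.tri, slope v t = 0) (hn : nodalSq (M.Pi v) = 0) : v = 0 := by
  have := connectedSpace_Ωh (M := M) hΩ.isConnected
  have hfin : (range (v : C(M.Ωh, ℝ))).Finite := by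
    refine ((M.tri.finite_toSet.biUnion fun t _ => t.finite_toSet).image
      (zeroExt (v : C(M.Ωh, ℝ)))).subset ?_
    rintro _ ⟨⟨x, hx⟩, rfl⟩
    obtain ⟨t, ht, hxt⟩ := mem_iUnion₂.1 hx
    obtain ⟨p, hp⟩ : t.Nonempty := Finset.card_pos.1 (by rw [M.card_tri t ht]; norm_num)
    refine ⟨p, mem_iUnion₂.2 ⟨t, ht, hp⟩, ?_⟩
    have h := sub_eq_inner_slope v ht (subset_convexHull ℝ _ hp) hxt
    rw [hs t ht, inner_zero_left, sub_eq_zero] at h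
    rw [h, zeroExt_apply _ hx]
  have hsub := (isPreconnected_range (v : C(M.Ωh, ℝ)).continuous).subsingleton_of_finite hfin
  obtain ⟨e, he⟩ := bd_nonempty (M := M) hΩ.frontier_nonempty
  obtain ⟨t, ht, het⟩ := M.bd_sub e he
  have hmem : M.F e 0 ∈ M.Ωh := M.mem_Ωh ht (subset_convexHull ℝ _ (het (M.F_zero_mem he)))
  have hz : (v : C(M.Ωh, ℝ)) ⟨M.F e 0, hmem⟩ = 0 := by
    rw [← zeroExt_apply _ hmem, ← zeroExt_Pi v he (M.F_zero_mem he), eq_zero_of_nodalSq hn]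
    exact zeroExt_zero _
  apply Subtype.ext
  ext y
  exact (hsub (mem_range_self y) (mem_range_self _)).trans hz

variable (M) in
/-- The nodal values of a function in `Q_h`. -/
noncomputable def nodalValues : M.Qh →ₗ[ℝ] (M.bd → ℝ × ℝ) where
  toFun μ e := (zeroExt (μ : C(frontier Ω, ℝ)) (M.F e 0), zeroExt (μ : C(frontier Ω, ℝ)) (M.F e 1))
  map_add' μ ν := by
    ext e <;> simp [zeroExt_add]
  map_smul' c μ := by
    ext e <;> simp [zeroExt_smul]

theorem norm_nodalValues_le (μ : M.Qh) : ‖M.nodalValues μ‖ ≤ Real.sqrt (nodalSq μ) := by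
  refine (pi_norm_le_iff_of_nonneg (Real.sqrt_nonneg _)).2 fun e => ?_
  have h := Finset.single_le_sum (f := fun e => zeroExt (μ : C(frontier Ω, ℝ)) (M.F e 0) ^ 2 +
    zeroExt (μ : C(frontier Ω, ℝ)) (M.F e 1) ^ 2) (fun _ _ => by positivity) e.2
  refine max_le (Real.abs_le_sqrt (le_trans ?_ h)) (Real.abs_le_sqrt (le_trans ?_ h))
  · exact le_add_of_nonneg_right (sq_nonneg _)
  · exact le_add_of_nonneg_left (sq_nonneg _)

theorem nodalValues_injective : Function.Injective M.nodalValues := by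
  refine (injective_iff_map_eq_zero _).2 fun μ h => eq_zero_of_nodalSq ?_
  refine Finset.sum_eq_zero fun e he => ?_
  have h1 := congrFun h ⟨e, he⟩
  have h2 : zeroExt (μ : C(frontier Ω, ℝ)) (M.F e 0) = 0 := congrArg Prod.fst h1
  have h3 : zeroExt (μ : C(frontier Ω, ℝ)) (M.F e 1) = 0 := congrArg Prod.snd h1
  rw [h2, h3]
  ring

variable (M) in
/-- Scaled gradients on the triangles and nodal values on the boundary of a function in `V_h`. -/
noncomputable def gradTrace : M.Vh →ₗ[ℝ] (M.tri → Plane) × (M.bd → ℝ × ℝ) :=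
  LinearMap.prod
    { toFun := fun v t =>
        Real.sqrt (volume.real (interior (convexHull ℝ (t : Set Plane)))) • slope v t
      map_add' := fun u v => funext fun t => by simp [slope_add u v t.2]
      map_smul' := fun c v => funext fun t => by
        simp only [slope_smul c v t.2, Pi.smul_apply, RingHom.id_apply]
        rw [smul_comm] }
    (M.nodalValues ∘ₗ M.PiLinear)

theorem gradTrace_injective (hΩ : IsSmoothBoundedDomain Ω) : Function.Injective M.gradTrace := by
  refine (injective_iff_map_eq_zero _).2 fun v h => ?_
  have h1 : (fun t : M.tri => Real.sqrt (volume.real (interior (convexHull ℝ (t : Set Plane)))) •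
    slope v t) = 0 := congrArg Prod.fst h
  have h2 : M.nodalValues (M.Pi v) = 0 := congrArg Prod.snd h
  refine eq_zero_of_slope_of_nodalSq hΩ (fun t ht => ?_) ?_
  · rcases smul_eq_zero.1 (congrFun h1 ⟨t, ht⟩) with h0 | h0
    · exfalso
      have hpos := isOpen_interior.measure_pos volume (M.interior_tri_nonempty ht)
      have hlt : volume (interior (convexHull ℝ (t : Set Plane))) < ⊤ :=
        (measure_mono interior_subset).trans_lt (isCompact_tri t).measure_lt_top
      exact (Real.sqrt_pos.2 (ENNReal.toReal_pos hpos.ne' hlt.ne)).ne' h0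
    · exact h0
  · rw [nodalValues_injective (h2.trans (map_zero _).symm)]
    exact Finset.sum_eq_zero fun e _ => by
      rw [Submodule.coe_zero, zeroExt_zero, zeroExt_zero]; ring

/-- Combined with injectivity of `gradTrace`, this makes `normV` definite and every linear
functional on `V_h` bounded with respect to it. -/
theorem norm_gradTrace_le {κ : ℝ} (hκ : 1 ≤ κ) (hM : M.IsRegular κ) (v : M.Vh) :
    ‖M.gradTrace v‖ ≤ 6 * κ * M.normV v := by
  have hV : 0 ≤ M.normV v := Real.sqrt_nonneg _
  have hsq := normV_sq v
  have hb := bdSq_nonneg v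
  have hg := M.gradInner_self_nonneg v
  refine max_le ?_ ?_
  · refine (pi_norm_le_iff_of_nonneg (by positivity)).2 fun t => ?_
    have h1 : ‖Real.sqrt (volume.real (interior (convexHull ℝ (t : Set Plane)))) • slope v t‖ ^ 2 ≤
        M.normV v ^ 2 := by
      rw [norm_smul, mul_pow, Real.norm_of_nonneg (Real.sqrt_nonneg _),
        Real.sq_sqrt measureReal_nonneg, ← real_inner_self_eq_norm_sq, hsq]
      refine le_add_of_le_of_nonneg ?_ hb
      rw [gradInner_eq_sum]
      exact Finset.single_le_sum (f := fun t : Finset Plane =>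
        volume.real (interior (convexHull ℝ (t : Set Plane))) * inner ℝ (slope v t) (slope v t))
        (fun _ _ => mul_nonneg measureReal_nonneg real_inner_self_nonneg) t.2
    exact (abs_le_of_sq_le_sq' h1 hV).2.trans (by nlinarith)
  · refine (norm_nodalValues_le (M.Pi v)).trans (Real.sqrt_le_iff.2 ⟨by positivity, ?_⟩)
    refine (nodalSq_le hκ hM v).trans ?_
    have h1 : M.bdSq v ≤ M.normV v ^ 2 := by linarith
    calc 6 * κ * M.bdSq v ≤ 6 * κ * M.normV v ^ 2 := by gcongr
      _ ≤ (6 * κ) ^ 2 * M.normV v ^ 2 := by gcongr; nlinarith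
      _ = _ := by ring

theorem finiteDimensional_Qh : FiniteDimensional ℝ M.Qh :=
  FiniteDimensional.of_injective _ nodalValues_injective

theorem finiteDimensional_Vh (hΩ : IsSmoothBoundedDomain Ω) : FiniteDimensional ℝ M.Vh :=
  FiniteDimensional.of_injective _ (gradTrace_injective hΩ)

end CurvedMesh

/-! ### Abstract saddle point problems -/

section SaddlePoint

variable {V Q : Type*} [AddCommGroup V] [Module ℝ V] [AddCommGroup Q] [Module ℝ Q]

/-- Unique solvability of a finite-dimensional saddle point problem. -/
theorem existsUnique_saddlePoint [FiniteDimensional ℝ V] [FiniteDimensional ℝ Q]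
    (a : V →ₗ[ℝ] V →ₗ[ℝ] ℝ) (m : Q →ₗ[ℝ] Q →ₗ[ℝ] ℝ) (P : V →ₗ[ℝ] Q)
    (hP : Function.Surjective P) (ha : ∀ u, a u u = 0 → P u = 0 → u = 0)
    (hm : ∀ μ, m μ μ = 0 → μ = 0) (ℓ : V →ₗ[ℝ] ℝ) (γ : Q →ₗ[ℝ] ℝ) :
    ∃! p : V × Q, (∀ v, a p.1 v + m p.2 (P v) = ℓ v) ∧ ∀ μ, m μ (P p.1) = γ μ := by
  let T : V × Q →ₗ[ℝ] Module.Dual ℝ V × Module.Dual ℝ Q :=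
    LinearMap.prod (a.coprod ((LinearMap.lcomp ℝ ℝ P) ∘ₗ m))
      ((m.flip ∘ₗ P) ∘ₗ LinearMap.fst ℝ V Q)
  have hT1 : ∀ p v, (T p).1 v = a p.1 v + m p.2 (P v) := fun p v => rfl
  have hT2 : ∀ p μ, (T p).2 μ = m μ (P p.1) := fun p μ => rfl
  have hinj : Function.Injective T := by
    -- For homogeneous data, test the constraint with `P u`, then the first equation with `u`, and
    -- finally with a preimage of the multiplier under `P`.
    refine (injective_iff_map_eq_zero _).2 fun p hp => ?_
    have h1 : ∀ v, a p.1 v + m p.2 (P v) = 0 := fun v => by rw [← hT1, hp]; rfl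
    have h2 : ∀ μ, m μ (P p.1) = 0 := fun μ => by rw [← hT2, hp]; rfl
    have hPu := hm _ (h2 (P p.1))
    have hu : p.1 = 0 := ha _ (by simpa [hPu] using h1 p.1) hPu
    have hl : p.2 = 0 := by
      obtain ⟨v, hv⟩ := hP p.2
      exact hm _ (by simpa [hu, hv] using h1 v)
    exact Prod.ext hu hl
  have hsurj : Function.Surjective T := by
    refine (LinearMap.injective_iff_surjective_of_finrank_eq_finrank ?_).1 hinj
    rw [Module.finrank_prod, Module.finrank_prod, Subspace.dual_finrank_eq,
      Subspace.dual_finrank_eq]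
  obtain ⟨p, hp⟩ := hsurj (ℓ, γ)
  refine ⟨p, ⟨fun v => by rw [← hT1, hp], fun μ => by rw [← hT2, hp]⟩, ?_⟩
  rintro q ⟨hq1, hq2⟩
  refine hinj (Prod.ext (LinearMap.ext fun v => ?_) (LinearMap.ext fun μ => ?_))
  · rw [hT1, hq1, hp]
  · rw [hT2, hq2, hp]

/-- Stability of a saddle point problem whose constraint controls a boundary seminorm and for which
the extension operator is bounded. The number `H` plays the role of the mesh size. -/
theorem saddlePoint_stability (a : V →ₗ[ℝ] V →ₗ[ℝ] ℝ) (m : Q →ₗ[ℝ] Q →ₗ[ℝ] ℝ) (P : V →ₗ[ℝ] Q)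
    (ha : ∀ v, 0 ≤ a v v) (hcs : ∀ u v, a u v ^ 2 ≤ a u u * a v v)
    {β NV : V → ℝ} {S NQ : Q → ℝ} {K H : ℝ} (hK : 1 ≤ K) (hH : 0 < H)
    (hS0 : ∀ μ, 0 ≤ S μ)
    (hNV : ∀ v, NV v ^ 2 = a v v + β v) (hNQ : ∀ μ, NQ μ ^ 2 ≤ K * (H ^ 2 * S μ))
    (hβ : ∀ v, β v ≤ K * S (P v)) (hm : ∀ μ, H * S μ ≤ K * m μ μ)
    (hlift : ∀ μ, ∃ v, P v = μ ∧ a v v ≤ K * S μ)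
    {w : V} {ν : Q} {A D : ℝ} (hA : 0 ≤ A) (hD : 0 ≤ D)
    (h1 : ∀ v, |a w v + m ν (P v)| ≤ A * NV v) (h2 : ∀ μ, |m μ (P w)| ≤ D * NQ μ) :
    NV w + NQ ν ≤ 21 * K ^ 6 * (A + D) := by
  have hNQ' : ∀ μ, NQ μ ≤ K * (H * Real.sqrt (S μ)) := by
    intro μ
    refine (abs_le_of_sq_le_sq' ?_ (by positivity)).2
    have e := Real.sq_sqrt (hS0 μ)
    calc NQ μ ^ 2 ≤ K * (H ^ 2 * S μ) := hNQ μ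
      _ ≤ K ^ 2 * (H ^ 2 * S μ) := by
          have := hS0 μ
          gcongr
          nlinarith
      _ = _ := by rw [mul_pow, mul_pow, e]
  set G := Real.sqrt (a w w) with hG
  have hG2 : G ^ 2 = a w w := Real.sq_sqrt (ha w)
  have hG0 : 0 ≤ G := Real.sqrt_nonneg _
  have hK0 : 0 < K := by linarith
  -- the multiplier
  have hν : NQ ν ≤ 2 * K ^ 3 * (G + A) := by
    -- The lift of `ν` turns the first equation into a bound for `m ν ν`, which is quadratic in `s`,
    -- by terms linear in `s`.
    obtain ⟨v, hv, hav⟩ := hlift ν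
    set s := Real.sqrt (S ν) with hs
    have hs2 : s ^ 2 = S ν := Real.sq_sqrt (hS0 ν)
    have hs0 : 0 ≤ s := Real.sqrt_nonneg _
    have hNVv : NV v ≤ 2 * K * s := by
      refine (abs_le_of_sq_le_sq' ?_ (by positivity)).2
      have := hβ v
      rw [hv] at this
      rw [hNV, mul_pow, hs2]
      nlinarith [hS0 ν, mul_nonneg hK0.le (hS0 ν)]
    have hawv : |a w v| ≤ G * (K * s) := by
      refine abs_le_of_sq_le_sq ?_ (by positivity)
      refine (hcs w v).trans ?_
      rw [mul_pow, hG2, mul_pow, hs2]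
      refine mul_le_mul_of_nonneg_left (hav.trans ?_) (ha w)
      nlinarith [mul_nonneg hK0.le (hS0 ν)]
    have hmν : m ν ν ≤ A * (2 * K * s) + G * (K * s) := by
      have e1 := h1 v
      rw [hv] at e1
      have e2 := (abs_le.1 e1).2
      have e3 := (abs_le.1 hawv).1
      have e4 := mul_le_mul_of_nonneg_left hNVv hA
      linarith
    have hHs : H * s ≤ 2 * K ^ 2 * (G + A) := by
      rcases hs0.eq_or_lt with h0 | hpos
      · rw [← h0, mul_zero]
        positivity
      · have e1 := hm ν
        have e2 := mul_le_mul_of_nonneg_left hmν hK0.le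
        refine le_of_mul_le_mul_right (a := s) ?_ hpos
        have e3 : 0 ≤ K ^ 2 * (G * s) := by positivity
        rw [← hs2] at e1
        linarith
    calc NQ ν ≤ K * (H * s) := hNQ' ν
      _ ≤ K * (2 * K ^ 2 * (G + A)) := by gcongr
      _ = _ := by ring
  -- the boundary part
  have hβw : NV w ≤ G + K ^ 3 * D := by
    set s := Real.sqrt (S (P w)) with hs
    have hs2 : s ^ 2 = S (P w) := Real.sq_sqrt (hS0 _)
    have hs0 : 0 ≤ s := Real.sqrt_nonneg _
    -- The constraint is tested with `P w`; coercivity produces `H s²` and the dual bound `H s`, so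
    -- one factor `H s` cancels.
    have hsD : s ≤ K ^ 2 * D := by
      rcases hs0.eq_or_lt with h0 | hpos
      · rw [← h0]
        positivity
      · have e1 := hm (P w)
        have e2 := ((abs_le.1 (h2 (P w))).2).trans (mul_le_mul_of_nonneg_left (hNQ' (P w)) hD)
        have e3 := mul_le_mul_of_nonneg_left e2 hK0.le
        rw [← hs2] at e1
        refine le_of_mul_le_mul_left (a := H * s) ?_ (by positivity)
        linarith
    have hβ2 : β w ≤ (K ^ 3 * D) ^ 2 := by
      have e1 : s ^ 2 ≤ (K ^ 2 * D) ^ 2 := pow_le_pow_left₀ hs0 hsD 2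
      have e2 := hβ w
      rw [← hs2] at e2
      calc β w ≤ K * s ^ 2 := e2
        _ ≤ K ^ 2 * (K ^ 2 * D) ^ 2 := by
            gcongr
            nlinarith
        _ = _ := by ring
    refine (abs_le_of_sq_le_sq' ?_ (by positivity)).2
    rw [hNV, ← hG2]
    have : 0 ≤ G * (K ^ 3 * D) := by positivity
    nlinarith
  -- the gradient part
  set X := A + D with hX
  have hX0 : 0 ≤ X := by positivity
  have hAX : A ≤ X := by linarith
  have hDX : D ≤ X := by linarith
  have hK3 : 1 ≤ K ^ 3 := one_le_pow₀ hK
  set L := K ^ 3 with hL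
  -- The first equation tested with `w`, minus the constraint tested with `ν`, isolates `G²`. If `G`
  -- exceeded `6 L X`, the right side would be at most `G² / 2 + G² / 12`.
  have hGX : G ≤ 6 * L * X := by
    have e1 := (abs_le.1 (h1 w)).2
    have e2 := (abs_le.1 (h2 ν)).1
    have e3 := mul_le_mul_of_nonneg_left hβw hA
    have e4 := mul_le_mul_of_nonneg_left hν hD
    have e5 : G ^ 2 ≤ A * (G + L * D) + D * (2 * L * (G + A)) := by
      rw [hG2]
      linarith
    have e6 : A * (G + L * D) + D * (2 * L * (G + A)) ≤ 3 * L * X * G + 3 * L * X ^ 2 := by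
      have f1 : A * G ≤ L * X * G := by
        refine mul_le_mul_of_nonneg_right ?_ hG0
        nlinarith
      have f2 : D * A ≤ X * X := mul_le_mul hDX hAX hA hX0
      have f3 : D * G ≤ X * G := mul_le_mul_of_nonneg_right hDX hG0
      have f4 := mul_le_mul_of_nonneg_left f2 (by positivity : 0 ≤ L)
      have f5 := mul_le_mul_of_nonneg_left f3 (by positivity : 0 ≤ L)
      nlinarith
    by_contra hcon
    push Not at hcon
    have g1 : 3 * L * X * G ≤ G / 2 * G := by
      refine mul_le_mul_of_nonneg_right ?_ hG0
      linarith
    have g2 : X ≤ L * X := by nlinarith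
    have g3 : 3 * L * X ^ 2 ≤ G / 2 * (G / 6) := by
      have : 3 * L * X ^ 2 = (3 * L * X) * X := by ring
      rw [this]
      refine mul_le_mul (by linarith) (by linarith) hX0 (by positivity)
    have hGpos : 0 < G := lt_of_le_of_lt (by positivity) hcon
    nlinarith
  -- The final constant is `21 = 6 + 1 + 12 + 2`.
  have hfin : NV w + NQ ν ≤ (6 * L * X + L * D) + 2 * L * (6 * L * X + A) := by
    have : 2 * L * (G + A) ≤ 2 * L * (6 * L * X + A) := by gcongr
    linarith
  have hLL : L ≤ L ^ 2 := by nlinarith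
  have hL6 : K ^ 6 = L ^ 2 := by rw [hL]; ring
  rw [hL6]
  have k1 : L * D ≤ L * X := by gcongr
  have k2 : L * A ≤ L * X := by gcongr
  have k3 : L * X ≤ L ^ 2 * X := by gcongr
  nlinarith

/-- A linear functional is bounded by any function that controls an injective linear map into a
finite-dimensional normed space. -/
theorem exists_abs_le_mul_of_injective {F : Type*} [NormedAddCommGroup F] [NormedSpace ℝ F]
    [FiniteDimensional ℝ F] {T : V →ₗ[ℝ] F} (hT : Function.Injective T) {N : V → ℝ} {c : ℝ}
    (hN : ∀ v, ‖T v‖ ≤ c * N v) (ℓ : V →ₗ[ℝ] ℝ) : ∃ D, ∀ v, |ℓ v| ≤ D * N v := by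
  -- The functional factors through `T` by a left inverse, and linear functionals on `F` are
  -- continuous.
  obtain ⟨R, hR⟩ := T.exists_leftInverse_of_injective (LinearMap.ker_eq_bot.2 hT)
  let L : F →L[ℝ] ℝ := LinearMap.toContinuousLinearMap (ℓ ∘ₗ R)
  refine ⟨‖L‖ * c, fun v => ?_⟩
  have h : ℓ v = L (T v) := by
    have : R (T v) = v := LinearMap.congr_fun hR v
    simp [L, this]
  rw [h, mul_assoc]
  exact (L.le_opNorm (T v)).trans (mul_le_mul_of_nonneg_left (hN v) (norm_nonneg _))

/-- A linear functional is bounded by its dual norm. -/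
theorem abs_le_iSup_div_mul {N : V → ℝ} (hN : ∀ v, v ≠ 0 → 0 < N v) (ℓ : V →ₗ[ℝ] ℝ)
    {D : ℝ} (hD : ∀ v, |ℓ v| ≤ D * N v) (hN0 : ∀ v, 0 ≤ N v) (v : V) :
    |ℓ v| ≤ (⨆ u : {u : V // u ≠ 0}, |ℓ u| / N u) * N v := by
  by_cases hv : v = 0
  · rw [hv, map_zero, abs_zero]
    exact mul_nonneg (Real.iSup_nonneg fun u => div_nonneg (abs_nonneg _) (hN0 _)) (hN0 _)
  · rw [← div_le_iff₀ (hN v hv)]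
    -- A real `⨆` over an unbounded family takes a default value; the constant `D` is there only to
    -- exclude this.
    refine le_ciSup (f := fun u : {u : V // u ≠ 0} => |ℓ u| / N u) ⟨D, ?_⟩ ⟨v, hv⟩
    rintro _ ⟨u, rfl⟩
    exact (div_le_iff₀ (hN u.1 u.2)).2 (hD u.1)

end SaddlePoint

/-! ### The discrete problem and the error estimate -/

namespace CurvedMesh

variable {Ω : Set Plane} {M : CurvedMesh Ω} {n : ℕ} {x : Fin n → frontier Ω}

theorem gradInner_sq_le (u v : M.Vh) :
    M.gradInner u v ^ 2 ≤ M.gradInner u u * M.gradInner v v := by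
  have h := LinearMap.BilinForm.apply_mul_apply_le_of_forall_zero_le M.gradForm
    M.gradInner_self_nonneg u v
  simp only [gradForm_apply] at h
  rwa [M.gradInner_comm v u, ← sq] at h

theorem integrableOn_mul_zeroExt (u v : M.Vh) :
    IntegrableOn (fun y => zeroExt (u : C(M.Ωh, ℝ)) y * zeroExt (v : C(M.Ωh, ℝ)) y) M.Ωh := by
  have hc : ∀ v : M.Vh, ContinuousOn (zeroExt (v : C(M.Ωh, ℝ))) M.Ωh := fun v => by
    rw [continuousOn_iff_continuous_domRestrict]
    refine (v : C(M.Ωh, ℝ)).continuous.congr fun y => ?_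
    exact (zeroExt_apply _ y.2).symm
  exact ((hc u).mul (hc v)).integrableOn_compact M.isCompact_Ωh

/-- The load functional `v ↦ (u, v)_{Ω_h}`. -/
noncomputable def l2Functional (u : M.Vh) : M.Vh →ₗ[ℝ] ℝ where
  toFun := M.l2Inner u
  map_add' v w := by
    rw [l2Inner, l2Inner, l2Inner, ← integral_add (integrableOn_mul_zeroExt u v)
      (integrableOn_mul_zeroExt u w)]
    simp only [Submodule.coe_add, zeroExt_add, mul_add]
  map_smul' c v := by
    rw [l2Inner, l2Inner, RingHom.id_apply, smul_eq_mul, ← integral_const_mul]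
    simp only [Submodule.coe_smul, zeroExt_smul, mul_left_comm]

variable (M x) in
/-- The empirical inner product as a bilinear form on data. -/
noncomputable def empForm : (Fin n → ℝ) →ₗ[ℝ] (Fin n → ℝ) →ₗ[ℝ] ℝ :=
  LinearMap.mk₂ ℝ (M.emp x)
    (fun a b c => by
      simp only [emp, ← Finset.sum_add_distrib, Pi.add_apply]
      exact Finset.sum_congr rfl fun _ _ => by ring)
    (fun r a b => by
      simp only [emp, Finset.mul_sum, Pi.smul_apply, smul_eq_mul]
      exact Finset.sum_congr rfl fun _ _ => by ring)
    (fun a b c => by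
      simp only [emp, ← Finset.sum_add_distrib, Pi.add_apply]
      exact Finset.sum_congr rfl fun _ _ => by ring)
    (fun r a b => by
      simp only [emp, Finset.mul_sum, Pi.smul_apply, smul_eq_mul]
      exact Finset.sum_congr rfl fun _ _ => by ring)

variable (M x) in
/-- Evaluation at the measurement points. -/
noncomputable def atPtsLinear : M.Qh →ₗ[ℝ] (Fin n → ℝ) where
  toFun := atPts x
  map_add' _ _ := rfl
  map_smul' _ _ := rfl

variable (M x) in
/-- The empirical inner product on `Q_h`. -/
noncomputable def empQ : M.Qh →ₗ[ℝ] M.Qh →ₗ[ℝ] ℝ :=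
  (M.empForm x).compl₁₂ (M.atPtsLinear x) (M.atPtsLinear x)

theorem normV_pos {κ : ℝ} (hΩ : IsSmoothBoundedDomain Ω) (hκ : 1 ≤ κ) (hM : M.IsRegular κ)
    {v : M.Vh} (hv : v ≠ 0) : 0 < M.normV v := by
  have h1 := norm_gradTrace_le hκ hM v
  have h2 : 0 < ‖M.gradTrace v‖ :=
    norm_pos_iff.2 fun h => hv (gradTrace_injective hΩ (h.trans (map_zero _).symm))
  by_contra hcon
  have : 6 * κ * M.normV v ≤ 0 := mul_nonpos_of_nonneg_of_nonpos (by positivity) (not_lt.1 hcon)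
  linarith

theorem h_pos (hΩ : IsSmoothBoundedDomain Ω) : 0 < M.h := by
  obtain ⟨e, he⟩ := bd_nonempty (M := M) hΩ.frontier_nonempty
  obtain ⟨t, ht, -⟩ := M.bd_sub e he
  exact (diam_pos ht).trans_le (hK_le_h ht)

theorem norm_nodalValues_le_normQ {κ : ℝ} (hΩ : IsSmoothBoundedDomain Ω) (hκ : 1 ≤ κ)
    (hM : M.IsRegular κ) (μ : M.Qh) : ‖M.nodalValues μ‖ ≤ 24 * κ ^ 5 / M.h * M.normQ μ := by
  have hh := h_pos (M := M) hΩ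
  have hQ : 0 ≤ M.normQ μ := Real.sqrt_nonneg _
  have hκ5 : 1 ≤ κ ^ 5 := one_le_pow₀ hκ
  refine (norm_nodalValues_le μ).trans (Real.sqrt_le_iff.2 ⟨by positivity, ?_⟩)
  rw [mul_pow, div_pow, div_mul_eq_mul_div, le_div_iff₀ (by positivity), mul_comm]
  refine (h_sq_mul_nodalSq_le hκ hM μ).trans ?_
  gcongr
  nlinarith

theorem normQ_pos {κ : ℝ} (hΩ : IsSmoothBoundedDomain Ω) (hκ : 1 ≤ κ) (hM : M.IsRegular κ)
    {μ : M.Qh} (hμ : μ ≠ 0) : 0 < M.normQ μ := by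
  have h1 := norm_nodalValues_le_normQ hΩ hκ hM μ
  have h2 : 0 < ‖M.nodalValues μ‖ :=
    norm_pos_iff.2 fun h => hμ (nodalValues_injective (h.trans (map_zero _).symm))
  have hh := h_pos (M := M) hΩ
  by_contra hcon
  have : 24 * κ ^ 5 / M.h * M.normQ μ ≤ 0 :=
    mul_nonpos_of_nonneg_of_nonpos (by positivity) (not_lt.1 hcon)
  linarith

theorem abs_le_iSup_mul_normV {κ : ℝ} (hΩ : IsSmoothBoundedDomain Ω) (hκ : 1 ≤ κ)
    (hM : M.IsRegular κ) (ℓ : M.Vh →ₗ[ℝ] ℝ) (v : M.Vh) :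
    |ℓ v| ≤ (⨆ u : {u : M.Vh // u ≠ 0}, |ℓ u| / M.normV u) * M.normV v := by
  obtain ⟨D, hD⟩ := exists_abs_le_mul_of_injective (gradTrace_injective hΩ)
    (norm_gradTrace_le hκ hM) ℓ
  exact abs_le_iSup_div_mul (fun v hv => normV_pos hΩ hκ hM hv) ℓ hD
    (fun v => Real.sqrt_nonneg _) v

theorem abs_le_iSup_mul_normQ {κ : ℝ} (hΩ : IsSmoothBoundedDomain Ω) (hκ : 1 ≤ κ)
    (hM : M.IsRegular κ) (ℓ : M.Qh →ₗ[ℝ] ℝ) (μ : M.Qh) :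
    |ℓ μ| ≤ (⨆ u : {u : M.Qh // u ≠ 0}, |ℓ u| / M.normQ u) * M.normQ μ := by
  obtain ⟨D, hD⟩ := exists_abs_le_mul_of_injective nodalValues_injective
    (norm_nodalValues_le_normQ hΩ hκ hM) ℓ
  exact abs_le_iSup_div_mul (fun v hv => normQ_pos hΩ hκ hM hv) ℓ hD
    (fun v => Real.sqrt_nonneg _) μ

/-- Coercivity makes the empirical form definite on `Q_h`, and extension by zero makes `Π_h`
surjective. No smallness of `h` is required. -/
theorem existsUnique_isDiscreteSolution {κ B : ℝ} (hΩ : IsSmoothBoundedDomain Ω) (hκ : 1 ≤ κ)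
    (hM : M.IsRegular κ) (hB : 1 ≤ B) (hx : UniformlyDistributed x B)
    (h2 : ∀ e ∈ M.bd, 2 ≤ (M.pts x e).card) (f : Plane → ℝ) (g : Fin n → ℝ) :
    ∃! p : M.Vh × M.Qh, M.IsDiscreteSolution x f g p.1 p.2 := by
  have := finiteDimensional_Vh (M := M) hΩ
  have := finiteDimensional_Qh (M := M)
  refine existsUnique_saddlePoint M.gradForm (M.empQ x) M.PiLinear
    (fun μ => ⟨extend μ, Pi_extend μ⟩) (fun u hu hP => ?_) (fun μ hμ => ?_)
    (l2Functional (M.interp f)) ((M.empForm x).flip g ∘ₗ M.atPtsLinear x)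
  · refine eq_zero_of_slope_of_nodalSq hΩ (fun t ht => M.slope_eq_zero_of_gradInner_self hu ht) ?_
    rw [← PiLinear_apply, hP]
    exact Finset.sum_eq_zero fun e _ => by
      rw [Submodule.coe_zero, zeroExt_zero, zeroExt_zero]; ring
  · refine eq_zero_of_nodalSq (le_antisymm ?_ (nodalSq_nonneg μ))
    have h := h_mul_nodalSq_le hκ hM hB hx h2 μ
    rw [show M.emp x (atPts x μ) (atPts x μ) = 0 from hμ, mul_zero] at h
    exact nonpos_of_mul_nonpos_right h (h_pos hΩ)

end CurvedMesh

theorem theorem2p1 (Ω : Set Plane) (hΩ : IsSmoothBoundedDomain Ω) (κ B : ℝ) :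
    ∃ h₀ > 0, ∃ C > 0, ∀ M : CurvedMesh Ω, M.IsRegular κ → M.h ≤ h₀ →
      ∀ (n : ℕ) (x : Fin n → frontier Ω), UniformlyDistributed x B →
        (∀ e ∈ M.bd, 2 ≤ (M.pts x e).card) →
      ∀ (f : Plane → ℝ), ContinuousOn f (closure Ω) →
      ∀ (g₀ : C(frontier Ω, ℝ)) (e g : Fin n → ℝ), (∀ i, g i = g₀ (x i) + e i) →
        (∃! p : M.Vh × M.Qh, M.IsDiscreteSolution x f g p.1 p.2) ∧
        ∀ (u : M.Vh) (l : M.Qh), M.IsDiscreteSolution x f g u l →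
          ∀ (uI : M.Vh) (lI : M.Qh),
            M.normV (u - uI) + M.normQ (l - lI) ≤
              C * (M.err1 x f uI lI + M.err2 x g₀ uI + M.err3 x e) := by
  obtain ⟨r, hr, CΓ, hCΓ, harc⟩ := hΩ.exists_arcDist_le
  -- No sign or size of `κ` and `B` is assumed; enlarging them to at least 1 weakens the regularity
  -- hypotheses.
  set k := max κ 1 with hk
  set b := max B 1 with hb
  have hk1 : 1 ≤ k := le_max_right _ _
  have hb1 : 1 ≤ b := le_max_right _ _
  have hpi := Real.pi_pos
  -- The summands are the constants of the multiplier norm, of coercivity and of the lift; the first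
  -- also dominates the constant `k` of the boundary norm.
  set K := k * CΓ ^ 2 + 2592 * k ^ 3 * (4 * b * k ^ 2) ^ 3 + 256 * Real.pi * k ^ 6 with hKdef
  have hk0 : 0 < k := by linarith
  have hb0 : 0 < b := by linarith
  have hc1 : 1 ≤ CΓ ^ 2 := one_le_pow₀ hCΓ
  have hp1 : 0 < 2592 * k ^ 3 * (4 * b * k ^ 2) ^ 3 := by positivity
  have hp2 : 0 < 256 * Real.pi * k ^ 6 := by positivity
  have hkc : k ≤ k * CΓ ^ 2 := le_mul_of_one_le_right hk0.le hc1
  have hK1 : 1 ≤ K := by linarith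
  refine ⟨r / 2, by positivity, 21 * K ^ 6, by positivity, ?_⟩
  intro M hM hh n x hx h2 f _ g₀ e g hg
  have hM' := hM.mono (le_max_left κ 1)
  have hx' := hx.mono (le_max_left B 1)
  refine ⟨CurvedMesh.existsUnique_isDiscreteSolution hΩ hk1 hM' hb1 hx' h2 f g, ?_⟩
  intro u l ⟨hu1, hu2⟩ uI lI
  have hhpos := CurvedMesh.h_pos (M := M) hΩ
  have hE : ∀ e ∈ M.bd, M.hE e ≤ CΓ * M.h := fun e he =>
    CurvedMesh.hE_le_mul_h (by linarith) harc (by linarith) he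
  have hmul : ∀ {c t : ℝ}, c ≤ K → 0 ≤ t → c * t ≤ K * t := fun hc ht =>
    mul_le_mul_of_nonneg_right hc ht
  have herr1 : 0 ≤ M.err1 x f uI lI :=
    Real.iSup_nonneg fun _ => div_nonneg (abs_nonneg _) (Real.sqrt_nonneg _)
  have herr2 : 0 ≤ M.err2 x g₀ uI :=
    Real.iSup_nonneg fun _ => div_nonneg (abs_nonneg _) (Real.sqrt_nonneg _)
  have herr3 : 0 ≤ M.err3 x e :=
    Real.iSup_nonneg fun _ => div_nonneg (abs_nonneg _) (Real.sqrt_nonneg _)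
  rw [add_assoc]
  refine saddlePoint_stability M.gradForm (M.empQ x) M.PiLinear M.gradInner_self_nonneg
    CurvedMesh.gradInner_sq_le (β := M.bdSq) (S := CurvedMesh.nodalSq) (NV := M.normV)
    (NQ := M.normQ) (w := u - uI) (ν := l - lI) (K := K) hK1 hhpos CurvedMesh.nodalSq_nonneg
    CurvedMesh.normV_sq ?_ ?_ ?_ ?_ herr1 (add_nonneg herr2 herr3) ?_ ?_
  · intro μ
    have := CurvedMesh.nodalSq_nonneg μ
    exact (CurvedMesh.normQ_sq_le hk1 hM' hE μ).trans (hmul (by linarith) (by positivity))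
  · intro v
    exact (CurvedMesh.bdSq_le hk1 hM' v).trans
      (hmul (by linarith) (CurvedMesh.nodalSq_nonneg _))
  · intro μ
    have h3 := CurvedMesh.h_mul_nodalSq_le hk1 hM' hb1 hx' h2 μ
    refine h3.trans (hmul (by linarith) ?_)
    exact nonneg_of_mul_nonneg_right
      (h3.trans' (mul_nonneg hhpos.le (CurvedMesh.nodalSq_nonneg μ))) hp1
  · intro μ
    exact ⟨CurvedMesh.extend μ, CurvedMesh.Pi_extend μ,
      (CurvedMesh.gradInner_extend_le hk1 hM' μ).trans
        (hmul (by linarith) (CurvedMesh.nodalSq_nonneg _))⟩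
  · intro v
    have h3 := CurvedMesh.abs_le_iSup_mul_normV hΩ hk1 hM'
      (M.gradForm uI + M.empQ x lI ∘ₗ M.PiLinear - CurvedMesh.l2Functional (M.interp f)) v
    -- The discrete equation turns the left side into minus the consistency residual of `(uI, lI)`.
    have h4 : M.gradForm (u - uI) v + M.empQ x (l - lI) (M.PiLinear v) =
        -((M.gradForm uI + M.empQ x lI ∘ₗ M.PiLinear -
          CurvedMesh.l2Functional (M.interp f)) v) := by
      have h5 : M.gradForm u v + M.empQ x l (M.PiLinear v) =
        CurvedMesh.l2Functional (M.interp f) v := hu1 v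
      simp only [map_sub, LinearMap.sub_apply, LinearMap.add_apply, LinearMap.comp_apply]
      linarith
    rw [h4, abs_neg]
    exact h3
  · intro μ
    have h3 := CurvedMesh.abs_le_iSup_mul_normQ hΩ hk1 hM'
      ((M.empForm x).flip (fun i => CurvedMesh.atPts x (M.Pi uI) i - g₀ (x i)) ∘ₗ
        M.atPtsLinear x) μ
    have h4 := CurvedMesh.abs_le_iSup_mul_normQ hΩ hk1 hM'
      ((M.empForm x).flip e ∘ₗ M.atPtsLinear x) μ
    -- Since `g = g₀ + e` at the measurement points, the residual of the constraint splits into the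
    -- noise and the interpolation error of the boundary data.
    have h5 : M.empQ x μ (M.PiLinear (u - uI)) =
        M.emp x (CurvedMesh.atPts x μ) e - M.emp x (CurvedMesh.atPts x μ)
          (fun i => CurvedMesh.atPts x (M.Pi uI) i - g₀ (x i)) := by
      have h6 : M.empQ x μ (M.PiLinear u) = M.empForm x (CurvedMesh.atPts x μ) g := hu2 μ
      have h7 : g = (fun i => g₀ (x i)) + e := funext hg
      have h8 : (fun i => CurvedMesh.atPts x (M.Pi uI) i - g₀ (x i)) =
        M.atPtsLinear x (M.PiLinear uI) - fun i => g₀ (x i) := rfl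
      change _ = M.empForm x _ _ - M.empForm x _ _
      rw [map_sub, map_sub, h6, h7, h8, map_add, map_sub]
      change _ - M.empForm x _ _ = _
      abel
    rw [h5, add_mul]
    refine (abs_sub _ _).trans ?_
    rw [add_comm]
    exact add_le_add h3 h4
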